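/- Let $m\ge 2$ and $n\ge 1$ be integers, and let $\eta=(\eta_1,\dots,\eta_n)$ be a vector of integers with $m>\eta_1>\eta_2>\dots>\eta_n\ge 0$; write $|\eta|=\eta_1+\dots+\eta_n$. A walk on the $m$-circle from $\eta$ with $k$ standard steps is a sequence of $k$ steps, each of the form $+e_j$ or $-e_j$ with $e_j$ a standard unit vector of $\mathbb Z^n$ $(1\le j\le n)$, performed successively from $\eta$, where coordinates are read modulo $m$; walks with different step sequences are counted as different. Let $N_k(\eta)$ be the number of such walks with exactly $k$ steps and arbitrary end point such that at no time (including the start and the end) two coordinates of a point on the walk are equal modulo $m$. Write $a_k\sim b_k$ as $k\to\infty$ if $a_k=(1+\varepsilon_k)\,b_k$ for all large $k$, with $\varepsilon_k\to0$ (so for $n=m$, where both sides vanish for $k\ge1$, the relation holds trivially). Then, as $k\to\infty$: 1. if $n$ and $m$ are both even, $$N_k(\eta)\sim\frac{2^{\binom n2}}{m^{n/2}}\left(2\,\frac{\sin\frac{n\pi}{m}}{\sin\frac{\pi}{m}}\right)^{k}\prod_{1\le h<t\le n}\sin\frac{\pi(\eta_h-\eta_t)}{m}\;\left(\prod_{h=1}^{n/2}\cot\frac{(2h-1)\pi}{2m}+(-1)^{|\eta|+k+\frac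 n2}\prod_{h=1}^{n/2}\tan\frac{(2h-1)\pi}{2m}\right);$$ 2. if $n$ is even and $m$ is odd, $$N_k(\eta)\sim\frac{2^{\binom n2}}{m^{n/2}}\left(2\,\frac{\sin\frac{n\pi}{m}}{\sin\frac{\pi}{m}}\right)^{k}\prod_{1\le h<t\le n}\sin\frac{\pi(\eta_h-\eta_t)}{m}\;\prod_{h=1}^{n/2}\cot\frac{(2h-1)\pi}{2m};$$ 3. if $n$ is odd (regardless of the parity of $m$), $$N_k(\eta)\sim\frac{2^{\binom n2}}{m^{(n-1)/2}}\left(2\,\frac{\sin\frac{n\pi}{m}}{\sin\frac{\pi}{m}}\right)^{k}\prod_{1\le h<t\le n}\sin\frac{\pi(\eta_h-\eta_t)}{m}\;\prod_{h=1}^{(n-1)/2}\cot\frac{h\pi}{m}.$$ -/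

import Mathlib

open Filter Asymptotics

namespace CircleWalk

/-- A standard step in dimension `n`: the pair `(j, ε)` with `ε = ±1` stands for the
step `ε e_j`, where `e_j` is the `j`-th standard unit vector. -/
abbrev Step (n : ℕ) : Type := Fin n × ℤˣ

/-- The integer vector `ε e_j` of the standard step `(j, ε)`. -/
def Step.vec {n : ℕ} (s : Step n) : Fin n → ℤ := Pi.single s.1 (s.2 : ℤ)

/-- The point in `ℤⁿ` reached from `η` after the first `j` of the `k` steps `w`, before
its coordinates are reduced modulo `m`. -/
def point {n k : ℕ} (η : Fin n → ℤ) (w : Fin k → Step n) (j : ℕ) : Fin n → ℤ :=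
  η + ∑ i ∈ Finset.univ.filter (fun i : Fin k => (i : ℕ) < j), (w i).vec

/-- At no time `0, 1, …, k` are two coordinates of the walk equal on the `m`-circle, that is,
after reduction modulo `m`. -/
def NonColliding (m : ℕ) {n k : ℕ} (η : Fin n → ℤ) (w : Fin k → Step n) : Prop :=
  ∀ j : ℕ, j ≤ k → Function.Injective fun h : Fin n => (point η w j h : ZMod m)

/-- The number of walks on the `m`-circle which start at `η` and proceed for exactly `k` standard
steps, such that at no time two coordinates are equal; the end point is arbitrary. -/
noncomputable def numWalks (m : ℕ) {n : ℕ} (η : Fin n → ℤ) (k : ℕ) : ℕ :=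
  Nat.card {w : Fin k → Step n // NonColliding m η w}

/-- The product of `sin (π (η_h - η_t) / m)` over `1 ≤ h < t ≤ n`. -/
noncomputable def sinProd (m : ℕ) {n : ℕ} (η : Fin n → ℤ) : ℝ :=
  ∏ h : Fin n, ∏ t ∈ Finset.Ioi h, Real.sin (Real.pi * ((η h : ℝ) - (η t : ℝ)) / (m : ℝ))

end CircleWalk

namespace CircleWalk

open Finset

/-! The walkers behave as free fermions on a ring. The sign `chi` of the product of sines vanishes
at collisions, is constant along non-colliding walks, is antisymmetric, and gains `(-1)^(n-1)` when
a coordinate moves by `m`. So the count times `chi` is the only candidate for a solution of the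
unrestricted recurrence that starts at `chi` and vanishes at collisions (`numWalks_mul_chi`). Such a
solution is the Fourier series `wave`, whose momenta are twisted to match the sign `(-1)^(n-1)`.
Antisymmetrization turns its plane waves into Slater determinants, which do vanish at collisions
(`factorial_mul_wave`).

The growth comes from the eigenvalues of largest modulus. The top one belongs, up to permutation,
only to the `n` momenta nearest zero (`eig_le`). Its negative occurs only for even `m`, at the same
momenta shifted by half a period. At the ground state the Slater determinant is a Vandermonde
determinant, hence the product of sines (`slater_ground`).

The remaining constant is the Fourier coefficient of `chi`. Summation by parts in one coordinate,
followed by pairing opposite momenta, removes two walkers at the cost of one cotangent, or one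
tangent for the shifted state (`signedSum_succ_succ`). For odd `n` and even `m` the shifted
coefficient is zero. For even `n` and `m` the tangent product is below the cotangent product when `n
< m`, so the oscillating main term stays away from zero. -/

theorem prod_prod_Ioi_mul {R : Type*} [CommMonoid R] {n : ℕ} (a : Fin n → R) :
    ∏ h, ∏ t ∈ Ioi h, (a h * a t) = ∏ h, a h ^ (n - 1) := by
  have h1 : ∏ h : Fin n, ∏ t ∈ Ioi h, a t = ∏ t : Fin n, ∏ _h ∈ Iio t, a t :=
    Finset.prod_comm' (by simp)
  simp_rw [Finset.prod_mul_distrib]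
  rw [h1, ← Finset.prod_mul_distrib]
  refine Finset.prod_congr rfl fun h _ => ?_
  rw [Finset.prod_const, Finset.prod_const, ← pow_add, Fin.card_Ioi, Fin.card_Iio]
  congr 1
  omega

/-! ### Signs of sines and the sign function `chi`. -/

/-- The sign of `sin (π d / m)`. -/
noncomputable def sg (m : ℕ) (d : ℤ) : ℝ := SignType.sign (Real.sin (Real.pi * (d : ℝ) / m))

/-- The sign of `sinProd m x`. -/
noncomputable def chi (m : ℕ) {n : ℕ} (x : Fin n → ℤ) : ℝ :=
  ∏ h, ∏ t ∈ Ioi h, sg m (x h - x t)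

theorem sg_neg (m : ℕ) (d : ℤ) : sg m (-d) = -sg m d := by
  unfold sg
  have : Real.pi * ((-d : ℤ) : ℝ) / m = -(Real.pi * (d : ℝ) / m) := by push_cast; ring
  rw [this, Real.sin_neg, Left.sign_neg]
  simp

theorem sg_zero (m : ℕ) : sg m 0 = 0 := by simp [sg]

theorem sin_add_mul {m : ℕ} (hm : m ≠ 0) (d q : ℤ) :
    Real.sin (Real.pi * ((d + m * q : ℤ) : ℝ) / m) =
      (-1) ^ q * Real.sin (Real.pi * (d : ℝ) / m) := by
  have hm' : (m : ℝ) ≠ 0 := by exact_mod_cast hm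
  rw [← Real.sin_add_int_mul_pi]
  congr 1
  push_cast
  field_simp

theorem sg_add_mul {m : ℕ} (hm : m ≠ 0) (d q : ℤ) : sg m (d + m * q) = (-1) ^ q * sg m d := by
  unfold sg
  rw [sin_add_mul hm]
  rcases Int.even_or_odd q with h | h
  · simp [h.neg_one_zpow]
  · rw [h.neg_one_zpow, neg_one_mul, Left.sign_neg]
    simp

theorem sin_pos_of_range {m : ℕ} {d : ℤ} (h0 : 0 < d) (h1 : d < m) :
    0 < Real.sin (Real.pi * (d : ℝ) / m) := by
  have hm : (0 : ℝ) < m := by exact_mod_cast h0.trans h1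
  have h0' : (0 : ℝ) < d := by exact_mod_cast h0
  have h1' : (d : ℝ) < m := by exact_mod_cast h1
  apply Real.sin_pos_of_pos_of_lt_pi
  · positivity
  · rw [div_lt_iff₀ hm]
    exact mul_lt_mul_of_pos_left h1' Real.pi_pos

theorem sg_of_pos {m : ℕ} {d : ℤ} (h0 : 0 < d) (h1 : d < m) : sg m d = 1 := by
  simp [sg, sign_pos (sin_pos_of_range h0 h1)]

theorem sg_of_neg {m : ℕ} {d : ℤ} (h0 : d < 0) (h1 : -m < d) : sg m d = -1 := by
  rw [← neg_neg d, sg_neg, sg_of_pos (by omega) (by omega)]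

theorem sg_of_dvd {m : ℕ} (hm : m ≠ 0) {d : ℤ} (h : (m : ℤ) ∣ d) : sg m d = 0 := by
  obtain ⟨q, rfl⟩ := h
  rw [← zero_add ((m : ℤ) * q), sg_add_mul hm, sg_zero, mul_zero]

theorem eq_emod_add (m : ℕ) (d : ℤ) : d = d % m + m * (d / m) :=
  (Int.emod_add_mul_ediv d m).symm

theorem sg_of_not_dvd {m : ℕ} (hm : m ≠ 0) {d : ℤ} (h : ¬ (m : ℤ) ∣ d) :
    sg m d = (-1) ^ (d / m) := by
  have hm' : (0 : ℤ) < m := by omega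
  conv_lhs => rw [eq_emod_add m d]
  have h1 := Int.emod_nonneg d hm'.ne'
  have h2 : d % m ≠ 0 := fun h' => h (Int.dvd_of_emod_eq_zero h')
  rw [sg_add_mul hm, sg_of_pos (by omega) (Int.emod_lt_of_pos d hm'), mul_one]

/-- The sine changes sign only at multiples of `m`, and a unit step between non-multiples cannot
jump over one. -/
theorem sg_add_one {m : ℕ} (hm : m ≠ 0) {d : ℤ} (h : ¬ (m : ℤ) ∣ d) (h' : ¬ (m : ℤ) ∣ d + 1) :
    sg m (d + 1) = sg m d := by
  rw [sg_of_not_dvd hm h, sg_of_not_dvd hm h', Int.add_ediv (by omega)]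
  have hm' : (0 : ℤ) < m := by omega
  have hm1 : (1 : ℤ) < m := by
    by_contra hc
    exact h (by rw [show (m : ℤ) = 1 by omega]; exact one_dvd d)
  have h1 := Int.emod_nonneg d hm'.ne'
  have h2 := Int.emod_lt_of_pos d hm'
  have h3 : d % m + 1 ≠ m := fun hc => h' (by
    rw [eq_emod_add m d]
    exact ⟨1 + d / m, by rw [add_right_comm, hc]; ring⟩)
  have h4 : (1 : ℤ) % m = 1 := Int.emod_eq_of_lt (by omega) hm1
  have h5 : (1 : ℤ) / m = 0 := Int.ediv_eq_zero_of_lt (by omega) hm1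
  rw [h4, h5, if_neg, add_zero, add_zero]
  rw [Int.natAbs_natCast]
  omega

theorem sg_eq_of_adjacent {m : ℕ} (hm : m ≠ 0) {d d' : ℤ} (h : ¬ (m : ℤ) ∣ d)
    (h' : ¬ (m : ℤ) ∣ d') (hd : |d' - d| ≤ 1) : sg m d' = sg m d := by
  rw [abs_le] at hd
  rcases (by omega : d' = d + 1 ∨ d = d' + 1 ∨ d' = d) with rfl | rfl | rfl
  · exact sg_add_one hm h h'
  · exact (sg_add_one hm h' h).symm
  · rfl

theorem chi_comp_perm (m : ℕ) {n : ℕ} (x : Fin n → ℤ) (σ : Equiv.Perm (Fin n)) :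
    chi m (x ∘ σ) = (Equiv.Perm.sign σ : ℤ) * chi m x := by
  have := σ.prod_Ioi_comp_eq_sign_mul_prod (f := fun i j => sg m (x i - x j))
    (fun i j => by rw [← sg_neg, neg_sub])
  simpa [chi] using this

/-- Each coordinate enters `n - 1` differences, and each sine is antiperiodic with antiperiod `m`.
This sign dictates the parity of the exponents `mom`. -/
theorem chi_add_mul {m : ℕ} (hm : m ≠ 0) {n : ℕ} (x q : Fin n → ℤ) :
    chi m (fun i => x i + m * q i) = (∏ i, ((-1 : ℝ) ^ q i) ^ (n - 1)) * chi m x := by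
  rw [← prod_prod_Ioi_mul]
  simp_rw [chi, ← Finset.prod_mul_distrib]
  refine Finset.prod_congr rfl fun h _ => Finset.prod_congr rfl fun t _ => ?_
  rw [show x h + m * q h - (x t + m * q t) = x h - x t + m * (q h - q t) by ring, sg_add_mul hm,
    zpow_sub₀ (by norm_num)]
  congr 1
  rcases Int.even_or_odd (q t) with h | h <;> simp [h.neg_one_zpow, div_neg]

theorem intCast_eq_iff_dvd_sub (m : ℕ) (a b : ℤ) : (a : ZMod m) = b ↔ (m : ℤ) ∣ a - b := by
  rw [eq_comm, ZMod.intCast_eq_intCast_iff_dvd_sub]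

theorem not_dvd_of_injective {m n : ℕ} {x : Fin n → ℤ}
    (hx : Function.Injective fun h => (x h : ZMod m)) {a b : Fin n} (hab : a ≠ b) :
    ¬ (m : ℤ) ∣ x a - x b :=
  fun h => hab (hx ((intCast_eq_iff_dvd_sub m _ _).2 h))

theorem chi_eq_zero {m : ℕ} (hm : m ≠ 0) {n : ℕ} {x : Fin n → ℤ}
    (hx : ¬ Function.Injective fun h => (x h : ZMod m)) : chi m x = 0 := by
  simp only [Function.Injective, not_forall] at hx
  obtain ⟨a, b, hab, hne⟩ := hx
  rw [intCast_eq_iff_dvd_sub] at hab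
  rcases lt_or_gt_of_ne hne with h | h
  · exact Finset.prod_eq_zero (mem_univ a) (Finset.prod_eq_zero (mem_Ioi.2 h) (sg_of_dvd hm hab))
  · exact Finset.prod_eq_zero (mem_univ b) (Finset.prod_eq_zero (mem_Ioi.2 h)
      (sg_of_dvd hm (by rw [← neg_sub, dvd_neg]; exact hab)))

/-- A step moves every difference by at most one, so no difference can change its sign without first
hitting a multiple of `m`. -/
theorem chi_add_vec {m : ℕ} (hm : m ≠ 0) {n : ℕ} {x : Fin n → ℤ} (s : Step n)
    (hx : Function.Injective fun h => (x h : ZMod m))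
    (hx' : Function.Injective fun h => ((x + s.vec) h : ZMod m)) :
    chi m (x + s.vec) = chi m x := by
  refine Finset.prod_congr rfl fun h _ => Finset.prod_congr rfl fun t ht => ?_
  have hne : h ≠ t := (mem_Ioi.1 ht).ne
  refine sg_eq_of_adjacent hm (not_dvd_of_injective hx hne) (not_dvd_of_injective hx' hne) ?_
  obtain ⟨j, e⟩ := s
  have he : |((e : ℤˣ) : ℤ)| = 1 := by rcases Int.units_eq_one_or e with rfl | rfl <;> simp
  simp only [Pi.add_apply, Step.vec]
  rw [show ∀ a b c d : ℤ, a + b - (c + d) - (a - c) = b - d by intros; ring]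
  by_cases h1 : h = j
  · have h2 : t ≠ j := fun h' => hne (h1.trans h'.symm)
    subst h1
    rw [Pi.single_eq_same, Pi.single_eq_of_ne h2, sub_zero, he]
  · rw [Pi.single_eq_of_ne h1, zero_sub, abs_neg]
    by_cases h2 : t = j
    · subst h2
      rw [Pi.single_eq_same, he]
    · rw [Pi.single_eq_of_ne h2]; simp

theorem sign_sinProd (m : ℕ) {n : ℕ} (x : Fin n → ℤ) :
    chi m x = (SignType.sign (sinProd m x) : ℝ) := by
  have h : ∀ y : ℝ, ((SignType.sign y : SignType) : ℝ) =
      (SignType.castHom : SignType →*₀ ℝ) (signHom y) := fun y => rfl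
  simp only [chi, sg, sinProd, h, map_prod, Int.cast_sub]

theorem chi_mul_sinProd (m : ℕ) {n : ℕ} (x : Fin n → ℤ) :
    chi m x * sinProd m x = |sinProd m x| := by
  rw [sign_sinProd, sign_mul_self]

theorem sinProd_pos {m n : ℕ} {η : Fin n → ℤ} (hη : StrictAnti η) (h0 : ∀ h, 0 ≤ η h)
    (h1 : ∀ h, η h < m) : 0 < sinProd m η := by
  refine Finset.prod_pos fun h _ => Finset.prod_pos fun t ht => ?_
  have := hη (mem_Ioi.1 ht)
  have a := h0 t
  have b := h1 h
  have := sin_pos_of_range (m := m) (d := η h - η t) (by omega) (by omega)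
  push_cast at this
  exact this

theorem chi_eq_one {m n : ℕ} {η : Fin n → ℤ} (hη : StrictAnti η) (h0 : ∀ h, 0 ≤ η h)
    (h1 : ∀ h, η h < m) : chi m η = 1 := by
  rw [sign_sinProd, sign_pos (sinProd_pos hη h0 h1)]
  simp

theorem injective_of_strictAnti {m n : ℕ} {η : Fin n → ℤ} (hη : StrictAnti η)
    (h0 : ∀ h, 0 ≤ η h) (h1 : ∀ h, η h < m) : Function.Injective fun h => (η h : ZMod m) := by
  intro a b hab
  have hab' : (η a : ZMod m) = η b := hab
  rw [ZMod.intCast_eq_intCast_iff', Int.emod_eq_of_lt (h0 a) (h1 a),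
    Int.emod_eq_of_lt (h0 b) (h1 b)] at hab'
  exact hη.injective hab'

theorem chi_cons (m : ℕ) {n : ℕ} (t : ℤ) (s : Fin n → ℤ) :
    chi m (Fin.cons t s : Fin (n + 1) → ℤ) = (∏ j, sg m (t - s j)) * chi m s := by
  rw [chi, Fin.prod_univ_succ]
  congr 1
  · rw [Fin.prod_Ioi_zero]
    simp
  · refine Finset.prod_congr rfl fun h _ => ?_
    rw [Fin.prod_Ioi_succ]
    simp

/-! ### Recurrence for the walk counts. -/

theorem point_zero {n k : ℕ} (η : Fin n → ℤ) (w : Fin k → Step n) : point η w 0 = η := by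
  simp [point]

theorem point_cons_succ {n k : ℕ} (η : Fin n → ℤ) (s : Step n) (w : Fin k → Step n) (j : ℕ) :
    point η (Fin.cons s w : Fin (k + 1) → Step n) (j + 1) = point (η + s.vec) w j := by
  simp only [point, Finset.sum_filter]
  rw [Fin.sum_univ_succ]
  simp [add_assoc]

theorem nonColliding_cons {m n k : ℕ} (η : Fin n → ℤ) (s : Step n) (w : Fin k → Step n) :
    NonColliding m η (Fin.cons s w : Fin (k + 1) → Step n) ↔
      (Function.Injective fun h => (η h : ZMod m)) ∧ NonColliding m (η + s.vec) w := by
  constructor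
  · refine fun H => ⟨by simpa [point_zero] using H 0 (Nat.zero_le _), fun j hj => ?_⟩
    simpa [point_cons_succ] using H (j + 1) (by omega)
  · rintro ⟨h0, H⟩ j hj
    cases j with
    | zero => simpa [point_zero] using h0
    | succ j => simpa [point_cons_succ] using H j (by omega)

open Classical in
theorem numWalks_eq_sum (m : ℕ) {n : ℕ} (η : Fin n → ℤ) (k : ℕ) :
    numWalks m η k = ∑ w : Fin k → Step n, if NonColliding m η w then 1 else 0 := by
  rw [numWalks, Nat.card_eq_fintype_card, Fintype.card_subtype, Finset.card_filter]

open Classical in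
theorem numWalks_zero (m : ℕ) {n : ℕ} (η : Fin n → ℤ) :
    numWalks m η 0 = if (Function.Injective fun h => (η h : ZMod m)) then 1 else 0 := by
  rw [numWalks_eq_sum, Fintype.sum_unique]
  congr 1
  rw [NonColliding]
  simp [point_zero]

theorem numWalks_eq_zero (m : ℕ) {n : ℕ} {η : Fin n → ℤ} (k : ℕ)
    (h : ¬ Function.Injective fun h => (η h : ZMod m)) : numWalks m η k = 0 := by
  classical
  rw [numWalks_eq_sum]
  refine Finset.sum_eq_zero fun w _ => if_neg fun H => h ?_
  simpa [point_zero] using H 0 (Nat.zero_le _)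

theorem numWalks_succ (m : ℕ) {n : ℕ} {η : Fin n → ℤ} (k : ℕ)
    (h : Function.Injective fun h => (η h : ZMod m)) :
    numWalks m η (k + 1) = ∑ s : Step n, numWalks m (η + s.vec) k := by
  classical
  simp_rw [numWalks_eq_sum]
  rw [← (Fin.consEquiv fun _ : Fin (k + 1) => Step n).sum_comp, Fintype.sum_prod_type]
  refine Finset.sum_congr rfl fun s _ => Finset.sum_congr rfl fun w _ => ?_
  have : (Fin.consEquiv fun _ : Fin (k + 1) => Step n) (s, w) = Fin.cons s w := rfl
  rw [this]
  simp only [nonColliding_cons, h, true_and]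

/-- A family of functions on `ℤⁿ` that starts with `chi`, satisfies the recurrence of the walk
counts on all of `ℤⁿ` and vanishes at collisions gives the signed walk counts. -/
theorem numWalks_mul_chi {m : ℕ} (hm : m ≠ 0) {n : ℕ} (W : ℕ → (Fin n → ℤ) → ℂ)
    (h0 : ∀ x, W 0 x = chi m x) (hs : ∀ k x, W (k + 1) x = ∑ s : Step n, W k (x + s.vec))
    (hc : ∀ k x, (¬ Function.Injective fun h => (x h : ZMod m)) → W k x = 0) (k : ℕ)
    (x : Fin n → ℤ) : (numWalks m x k : ℂ) * chi m x = W k x := by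
  induction k generalizing x with
  | zero =>
    rw [h0, numWalks_zero]
    split_ifs with h
    · simp
    · simp [chi_eq_zero hm h]
  | succ k ih =>
    by_cases h : Function.Injective fun h => (x h : ZMod m)
    · rw [hs, numWalks_succ m k h, Nat.cast_sum, Finset.sum_mul]
      refine Finset.sum_congr rfl fun s _ => ?_
      rw [← ih]
      -- The values of `chi` at `x` and at a colliding neighbour may differ, but no walk is counted
      -- from such a neighbour.
      by_cases h' : Function.Injective fun h => ((x + s.vec) h : ZMod m)
      · rw [chi_add_vec hm s h h']
      · rw [numWalks_eq_zero m k h']; simp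
    · rw [hc _ _ h, chi_eq_zero hm h]; simp

/-! ### Roots of unity, momenta and orthogonality. -/

/-- The primitive root of unity `exp (π i / m)` of order `2 m`. -/
noncomputable def zeta (m : ℕ) : ℂ := Complex.exp (Real.pi * Complex.I / m)

theorem zeta_ne_zero (m : ℕ) : zeta m ≠ 0 := Complex.exp_ne_zero _

theorem zeta_zpow (m : ℕ) (e : ℤ) :
    zeta m ^ e = Complex.exp ((Real.pi * e / m : ℝ) * Complex.I) := by
  rw [zeta, ← Complex.exp_int_mul]
  congr 1
  push_cast
  ring

theorem zeta_zpow_eq (m : ℕ) (e : ℤ) :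
    zeta m ^ e = Real.cos (Real.pi * e / m) + Real.sin (Real.pi * e / m) * Complex.I := by
  rw [zeta_zpow, Complex.exp_mul_I]
  push_cast
  rfl

theorem zeta_zpow_mul {m : ℕ} (hm : m ≠ 0) (q : ℤ) : zeta m ^ ((m : ℤ) * q) = (-1) ^ q := by
  have hm' : (m : ℂ) ≠ 0 := by exact_mod_cast hm
  rw [zpow_mul]
  congr 1
  rw [zeta_zpow, ← Complex.exp_pi_mul_I]
  congr 1
  push_cast
  field_simp

theorem zeta_zpow_two_mul_eq_one_iff {m : ℕ} (hm : m ≠ 0) (e : ℤ) :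
    zeta m ^ (2 * e) = 1 ↔ (m : ℤ) ∣ e := by
  have h := Complex.isPrimitiveRoot_exp m hm
  rw [← h.zpow_eq_one_iff_dvd, zpow_mul]
  have : zeta m ^ (2 : ℤ) = Complex.exp (2 * Real.pi * Complex.I / m) := by
    rw [zeta_zpow]
    congr 1
    push_cast
    ring
  rw [this]

theorem zeta_star (m : ℕ) (e : ℤ) : star (zeta m ^ e) = zeta m ^ (-e) := by
  rw [zeta_zpow, zeta_zpow, Complex.star_def, ← Complex.exp_conj]
  congr 1
  simp only [map_mul, Complex.conj_I, Complex.conj_ofReal]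
  push_cast
  ring

theorem sum_zeta {m : ℕ} (hm : m ≠ 0) (e : ℤ) :
    ∑ j : Fin m, (zeta m ^ (2 * e)) ^ (j : ℕ) = if (m : ℤ) ∣ e then (m : ℂ) else 0 := by
  split_ifs with h
  · rw [(zeta_zpow_two_mul_eq_one_iff hm e).2 h]
    simp
  · have h1 : zeta m ^ (2 * e) ≠ 1 := fun h' => h ((zeta_zpow_two_mul_eq_one_iff hm e).1 h')
    rw [Fin.sum_univ_eq_sum_range (fun j => (zeta m ^ (2 * e)) ^ j), geom_sum_eq h1,
      ← zpow_natCast, ← zpow_mul, show 2 * e * (m : ℤ) = m * (2 * e) by ring, zeta_zpow_mul hm, (even_two_mul e).neg_one_zpow]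
    simp

/-- Exponent of the `j`-th momentum for `n` walkers: the momenta are `zeta m ^ mom n j`. -/
def mom (n : ℕ) (j : ℤ) : ℤ := 2 * j - (n - 1)

/-- Here `zeta m ^ m = -1` and `mom (n + 1) j` has the parity of `n`, so every plane wave has the
quasi-periodicity of `chi` for `n + 1` walkers. -/
theorem zeta_mom_mul {m : ℕ} (hm : m ≠ 0) (n : ℕ) (j q : ℤ) :
    zeta m ^ (mom (n + 1) j * (m * q)) = ((-1) ^ q) ^ n := by
  rw [show mom (n + 1) j * (m * q) = m * (mom (n + 1) j * q) by ring, zeta_zpow_mul hm, mom,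
    Nat.cast_succ, add_sub_cancel_right, mul_comm, ← zpow_natCast, zpow_mul, zpow_sub₀ (by
      rcases Int.even_or_odd q with h | h <;> simp [h.neg_one_zpow]), zpow_mul]
  rcases Int.even_or_odd q with h | h
  · simp [h.neg_one_zpow]
  · rcases Nat.even_or_odd n with h' | h' <;> simp [h.neg_one_zpow, h'.neg_one_pow]

/-- The sum over one momentum. -/
theorem sum_mom {m : ℕ} (hm : m ≠ 0) (n : ℕ) (d : ℤ) :
    ∑ j : Fin m, zeta m ^ (mom (n + 1) j * d) =
      if (m : ℤ) ∣ d then (m : ℂ) * ((-1) ^ (d / m)) ^ n else 0 := by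
  have h : ∀ j : Fin m, zeta m ^ (mom (n + 1) j * d) =
      zeta m ^ (-(n * d)) * (zeta m ^ (2 * d)) ^ (j : ℕ) := fun j => by
    rw [← zpow_natCast, ← zpow_mul, ← zpow_add₀ (zeta_ne_zero m)]
    congr 1
    rw [mom]
    push_cast
    ring
  simp_rw [h, ← Finset.mul_sum, sum_zeta hm]
  split_ifs with hd
  · obtain ⟨q, rfl⟩ := hd
    have hq := zeta_mom_mul hm n 0 q
    rw [mom] at hq
    rw [Int.mul_ediv_cancel_left _ (by omega), ← hq, mul_comm]
    congr 2
    push_cast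
    ring
  · simp

/-! ### The Fourier series of the signed counts. -/

/-- The Fourier coefficient of `chi` at the momenta `p`. -/
noncomputable def coef (m : ℕ) {n : ℕ} (p : Fin n → Fin m) : ℂ :=
  ∑ s : Fin n → Fin m, (chi m (fun i => (s i : ℤ)) : ℂ) *
    ∏ i, zeta m ^ (-(mom n (p i) * (s i : ℤ)))

/-- The eigenvalue of the step operator at the momenta `p`. -/
noncomputable def eig (m : ℕ) {n : ℕ} (p : Fin n → Fin m) : ℝ :=
  ∑ i, 2 * Real.cos (Real.pi * mom n (p i) / m)

/-- The Fourier series for the signed walk counts. -/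
noncomputable def wave (m : ℕ) {n : ℕ} (k : ℕ) (x : Fin n → ℤ) : ℂ :=
  ((m : ℂ) ^ n)⁻¹ * ∑ p : Fin n → Fin m,
    (eig m p : ℂ) ^ k * (coef m p * ∏ i, zeta m ^ (mom n (p i) * x i))

theorem eig_eq (m : ℕ) {n : ℕ} (p : Fin n → Fin m) :
    (eig m p : ℂ) = ∑ i, (zeta m ^ mom n (p i) + zeta m ^ (-mom n (p i))) := by
  rw [eig, Complex.ofReal_sum]
  refine Finset.sum_congr rfl fun i _ => ?_
  rw [zeta_zpow_eq, zeta_zpow_eq]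
  have : Real.pi * ((-mom n (p i) : ℤ) : ℝ) / m = -(Real.pi * mom n (p i) / m) := by
    push_cast; ring
  rw [this, Real.cos_neg, Real.sin_neg]
  push_cast
  ring

theorem sum_step {n : ℕ} (f : Step n → ℂ) : ∑ s, f s = ∑ i, (f (i, 1) + f (i, -1)) := by
  rw [Fintype.sum_prod_type]
  refine Finset.sum_congr rfl fun i _ => ?_
  rw [show (univ : Finset ℤˣ) = {1, -1} from rfl, Finset.sum_pair (by decide)]

theorem prod_zeta_add_vec (m : ℕ) {n : ℕ} (e x : Fin n → ℤ) (s : Step n) :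
    ∏ i, zeta m ^ (e i * (x + s.vec) i) =
      zeta m ^ (e s.1 * (s.2 : ℤ)) * ∏ i, zeta m ^ (e i * x i) := by
  simp_rw [Pi.add_apply, mul_add, zpow_add₀ (zeta_ne_zero m), Finset.prod_mul_distrib]
  rw [mul_comm]
  congr 1
  rw [Finset.prod_eq_single s.1]
  · simp [Step.vec]
  · intro b _ hb
    simp [Step.vec, Pi.single_eq_of_ne hb]
  · simp

/-- Plane waves are eigenfunctions of the sum over all steps, with eigenvalue `eig`. -/
theorem wave_succ (m : ℕ) {n : ℕ} (k : ℕ) (x : Fin n → ℤ) :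
    wave m (k + 1) x = ∑ s : Step n, wave m k (x + s.vec) := by
  simp_rw [wave]
  rw [← Finset.mul_sum, Finset.sum_comm]
  congr 1
  refine Finset.sum_congr rfl fun p _ => ?_
  simp_rw [prod_zeta_add_vec]
  rw [sum_step, pow_succ, eig_eq, ← eig_eq, eig_eq]
  rw [mul_assoc, Finset.sum_mul, Finset.mul_sum]
  refine Finset.sum_congr rfl fun i _ => ?_
  simp
  ring

/-- Fourier inversion on the box `[0, m)^(n+1)`; outside it both sides acquire the same
quasi-periodicity sign. -/
theorem wave_zero {m : ℕ} (hm : m ≠ 0) {n : ℕ} (x : Fin (n + 1) → ℤ) :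
    wave m 0 x = chi m x := by
  have hmC : (m : ℂ) ≠ 0 := by exact_mod_cast hm
  have hm' : (0 : ℤ) < m := by omega
  have h1 : ∀ p : Fin (n + 1) → Fin m, (eig m p : ℂ) ^ 0 *
      (coef m p * ∏ i, zeta m ^ (mom (n + 1) (p i) * x i)) =
      ∑ s : Fin (n + 1) → Fin m, (chi m (fun i => (s i : ℤ)) : ℂ) *
        ∏ i, zeta m ^ (mom (n + 1) (p i) * (x i - (s i : ℤ))) := fun p => by
    rw [pow_zero, one_mul, coef, Finset.sum_mul]
    refine Finset.sum_congr rfl fun s _ => ?_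
    rw [mul_assoc, ← Finset.prod_mul_distrib]
    congr 1
    refine Finset.prod_congr rfl fun i _ => ?_
    rw [← zpow_add₀ (zeta_ne_zero m)]
    congr 1
    ring
  rw [wave]
  simp_rw [h1]
  rw [Finset.sum_comm]
  simp_rw [← Finset.mul_sum]
  have h2 : ∀ s : Fin (n + 1) → Fin m,
      ∑ p : Fin (n + 1) → Fin m, ∏ i, zeta m ^ (mom (n + 1) (p i) * (x i - (s i : ℤ))) =
      ∏ i, if (m : ℤ) ∣ x i - (s i : ℤ) then (m : ℂ) * ((-1) ^ ((x i - (s i : ℤ)) / m)) ^ n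
        else 0 := fun s => by
    simp_rw [← sum_mom hm]
    rw [Finset.prod_univ_sum, Fintype.piFinset_univ]
  simp_rw [h2]
  -- By orthogonality only the residue vector of `x` survives in the sum over the box.
  let r : Fin (n + 1) → Fin m := fun i => ⟨(x i % m).toNat, by
    have := Int.emod_nonneg (x i) hm'.ne'
    have := Int.emod_lt_of_pos (x i) hm'
    omega⟩
  have hr : ∀ i, ((r i : ℕ) : ℤ) = x i % m := fun i =>
    Int.toNat_of_nonneg (Int.emod_nonneg (x i) hm'.ne')
  rw [Finset.sum_eq_single r]
  · have h3 : ∀ i, x i - (r i : ℤ) = m * (x i / m) := fun i => by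
      rw [hr]
      have := eq_emod_add m (x i)
      omega
    have h4 : x = fun i => (r i : ℤ) + m * (x i / m) := by
      ext i
      rw [hr]
      exact eq_emod_add m (x i)
    conv_rhs => rw [h4, chi_add_mul hm]
    simp_rw [h3]
    simp only [dvd_mul_right, if_true, Int.mul_ediv_cancel_left _ hm'.ne',
      Finset.prod_mul_distrib, Finset.prod_const, Finset.card_univ, Fintype.card_fin]
    push_cast
    field_simp
  · intro s _ hs
    obtain ⟨i, hi⟩ := Function.ne_iff.1 hs
    rw [Finset.prod_eq_zero (mem_univ i), mul_zero]
    refine if_neg fun hd => hi (Fin.ext ?_)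
    have h6 : x i % m = (s i : ℤ) % m := (Int.modEq_iff_dvd.2 hd).symm
    rw [← hr, Int.emod_eq_of_lt (by omega) (by have := (s i).2; omega)] at h6
    exact_mod_cast h6.symm
  · simp

/-! ### Antisymmetrization and Slater determinants. -/

theorem sum_comp_perm {n : ℕ} {ι : Type*} [Fintype ι] (σ : Equiv.Perm (Fin n))
    (F : (Fin n → ι) → ℂ) : ∑ s : Fin n → ι, F (s ∘ σ) = ∑ s : Fin n → ι, F s :=
  Equiv.sum_comp (Equiv.arrowCongr σ.symm (Equiv.refl ι)) F

theorem sign_mul_sign {n : ℕ} (σ : Equiv.Perm (Fin n)) :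
    (((Equiv.Perm.sign σ : ℤˣ) : ℤ) : ℂ) * ((Equiv.Perm.sign σ : ℤˣ) : ℤ) = 1 := by
  rw [← Int.cast_mul, Int.units_coe_mul_self, Int.cast_one]

/-- Antisymmetrization of a sum against an antisymmetric function. -/
theorem factorial_mul_sum {n : ℕ} {ι : Type*} [Fintype ι] (A : (Fin n → ι) → ℂ)
    (hA : ∀ (s : Fin n → ι) (σ : Equiv.Perm (Fin n)),
      A (s ∘ σ) = ((Equiv.Perm.sign σ : ℤˣ) : ℤ) * A s)
    (f : Fin n → ι → ℂ) :
    (n.factorial : ℂ) * ∑ s, A s * ∏ i, f i (s i) =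
      ∑ s, A s * (Matrix.of fun i j => f i (s j)).det := by
  simp_rw [Matrix.det_apply', Finset.mul_sum]
  rw [Finset.sum_comm]
  have h : ∀ σ : Equiv.Perm (Fin n), ∑ s : Fin n → ι, A s * (((Equiv.Perm.sign σ : ℤˣ) : ℤ) *
      ∏ i, Matrix.of (fun i j => f i (s j)) (σ i) i) = ∑ s, A s * ∏ i, f i (s i) := fun σ => by
    rw [← sum_comp_perm σ]
    refine Finset.sum_congr rfl fun s _ => ?_
    rw [hA, ← Equiv.prod_comp σ (fun i => f i (s i))]
    simp only [Matrix.of_apply, Function.comp_apply]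
    linear_combination (A s * ∏ i, f (σ i) (s (σ i))) * sign_mul_sign σ
  simp_rw [h]
  rw [Finset.sum_const, Finset.card_univ, Fintype.card_perm, Fintype.card_fin, nsmul_eq_mul,
    Finset.mul_sum]

/-- The Slater determinant of the momenta `p` at the point `x`. -/
noncomputable def slater (m : ℕ) {n : ℕ} (p : Fin n → Fin m) (x : Fin n → ℤ) : ℂ :=
  (Matrix.of fun i j => zeta m ^ (mom n (p i) * x j)).det

theorem chi_comp_perm_cast (m : ℕ) {n : ℕ} (s : Fin n → Fin m) (σ : Equiv.Perm (Fin n)) :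
    (chi m (fun i => ((s ∘ σ) i : ℤ)) : ℂ) =
      ((Equiv.Perm.sign σ : ℤˣ) : ℤ) * (chi m (fun i => (s i : ℤ)) : ℂ) := by
  have := chi_comp_perm m (fun i => (s i : ℤ)) σ
  rw [show (fun i => ((s ∘ σ) i : ℤ)) = (fun i => (s i : ℤ)) ∘ σ from rfl, this]
  push_cast
  rfl

theorem coef_comp_perm (m : ℕ) {n : ℕ} (p : Fin n → Fin m) (σ : Equiv.Perm (Fin n)) :
    coef m (p ∘ σ) = ((Equiv.Perm.sign σ : ℤˣ) : ℤ) * coef m p := by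
  rw [coef, ← sum_comp_perm σ, coef, Finset.mul_sum]
  refine Finset.sum_congr rfl fun s _ => ?_
  rw [chi_comp_perm_cast, mul_assoc]
  congr 2
  exact Equiv.prod_comp σ fun i => zeta m ^ (-(mom n (p i) * (s i : ℤ)))

theorem eig_comp_perm (m : ℕ) {n : ℕ} (p : Fin n → Fin m) (σ : Equiv.Perm (Fin n)) :
    eig m (p ∘ σ) = eig m p :=
  Equiv.sum_comp σ fun i => 2 * Real.cos (Real.pi * mom n (p i) / m)

theorem slater_comp_perm (m : ℕ) {n : ℕ} (p : Fin n → Fin m) (σ : Equiv.Perm (Fin n))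
    (x : Fin n → ℤ) : slater m (p ∘ σ) x = ((Equiv.Perm.sign σ : ℤˣ) : ℤ) * slater m p x := by
  rw [slater, slater, ← Matrix.det_permute]
  rfl

theorem slater_eq_zero (m : ℕ) {n : ℕ} {p : Fin n → Fin m} (hp : ¬ Function.Injective p)
    (x : Fin n → ℤ) : slater m p x = 0 := by
  simp only [Function.Injective, not_forall] at hp
  obtain ⟨a, b, hab, hne⟩ := hp
  exact Matrix.det_zero_of_row_eq hne (by ext j; simp [hab])

/-- All momenta share one parity, so reducing a coordinate modulo `m` multiplies its whole column by
a single sign. Congruent coordinates then produce equal columns. -/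
theorem slater_eq_zero_of_collision {m : ℕ} (hm : m ≠ 0) {n : ℕ} (p : Fin (n + 1) → Fin m)
    {x : Fin (n + 1) → ℤ} (hx : ¬ Function.Injective fun h => (x h : ZMod m)) :
    slater m p x = 0 := by
  simp only [Function.Injective, not_forall] at hx
  obtain ⟨a, b, hab, hne⟩ := hx
  have h : slater m p x = (Matrix.of fun i j => (((-1 : ℂ) ^ (x j / m)) ^ n) *
      (Matrix.of fun i j => zeta m ^ (mom (n + 1) (p i) * (x j % m))) i j).det := by
    rw [slater]
    congr 1
    ext i j
    rw [Matrix.of_apply, Matrix.of_apply, Matrix.of_apply, ← zeta_mom_mul hm n (p i),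
      ← zpow_add₀ (zeta_ne_zero m)]
    congr 1
    conv_lhs => rw [eq_emod_add m (x j)]
    ring
  rw [h, Matrix.det_mul_row, Matrix.det_zero_of_column_eq hne, mul_zero]
  intro k
  rw [Matrix.of_apply, Matrix.of_apply, (ZMod.intCast_eq_intCast_iff' _ _ _).1 hab]

/-- `eig` is symmetric and `coef` antisymmetric in `p`, so only the antisymmetric part of each plane
wave counts. This form makes the vanishing at collisions visible. -/
theorem factorial_mul_wave (m : ℕ) {n : ℕ} (k : ℕ) (x : Fin n → ℤ) :
    (n.factorial : ℂ) * wave m k x =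
      ((m : ℂ) ^ n)⁻¹ * ∑ p : Fin n → Fin m, (eig m p : ℂ) ^ k * coef m p * slater m p x := by
  have h := factorial_mul_sum (fun p : Fin n → Fin m => (eig m p : ℂ) ^ k * coef m p)
    (fun p σ => by rw [eig_comp_perm, coef_comp_perm]; ring)
    (fun i j => zeta m ^ (mom n j * x i))
  rw [wave, mul_left_comm]
  congr 1
  simp_rw [← mul_assoc] at h ⊢
  rw [h]
  refine Finset.sum_congr rfl fun p _ => ?_
  rw [slater, ← Matrix.det_transpose]
  rfl

theorem wave_eq_zero {m : ℕ} (hm : m ≠ 0) {n : ℕ} (k : ℕ) {x : Fin (n + 1) → ℤ}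
    (hx : ¬ Function.Injective fun h => (x h : ZMod m)) : wave m k x = 0 := by
  have h := factorial_mul_wave m k x
  simp_rw [slater_eq_zero_of_collision hm _ hx] at h
  simpa [Nat.factorial_ne_zero] using h

theorem numWalks_eq_wave {m n : ℕ} (hm : m ≠ 0) {η : Fin (n + 1) → ℤ} (hη : StrictAnti η)
    (h0 : ∀ h, 0 ≤ η h) (h1 : ∀ h, η h < m) (k : ℕ) : (numWalks m η k : ℂ) = wave m k η := by
  have := numWalks_mul_chi hm (wave m) (wave_zero hm) (wave_succ m)
    (fun k x hx => wave_eq_zero hm k hx) k η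
  rwa [chi_eq_one hη h0 h1, Complex.ofReal_one, mul_one] at this

theorem factorial_mul_coef (m : ℕ) {n : ℕ} (p : Fin n → Fin m) :
    (n.factorial : ℂ) * coef m p = ∑ s : Fin n → Fin m, (chi m (fun i => (s i : ℤ)) : ℂ) *
      star (slater m p (fun i => (s i : ℤ))) := by
  have h := factorial_mul_sum (fun s : Fin n → Fin m => (chi m (fun i => (s i : ℤ)) : ℂ))
    (chi_comp_perm_cast m) (fun i t => zeta m ^ (-(mom n (p i) * (t : ℤ))))
  rw [coef, h]
  refine Finset.sum_congr rfl fun s _ => ?_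
  congr 1
  rw [slater, ← Matrix.det_conjTranspose, ← Matrix.det_transpose]
  congr 1
  ext i j
  simp only [Matrix.transpose_apply, Matrix.conjTranspose_apply, Matrix.of_apply, zeta_star]

/-! ### The ground state determinant. -/

/-- The constant relating the Slater determinant of the ground state to `sinProd`. -/
noncomputable def vdmConst (n : ℕ) : ℂ := ∏ h : Fin n, ∏ _t ∈ Ioi h, (-2 * Complex.I)

theorem norm_vdmConst (n : ℕ) : ‖vdmConst n‖ = 2 ^ n.choose 2 := by
  rw [vdmConst, norm_prod]
  simp_rw [norm_prod, norm_mul, norm_neg, Complex.norm_I, Complex.norm_ofNat, mul_one,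
    Finset.prod_const, Fin.card_Ioi]
  rw [Finset.prod_pow_eq_pow_sum, Fin.sum_univ_eq_sum_range (fun i => n - 1 - i),
    Finset.sum_range_reflect (fun i => i), Finset.sum_range_id, Nat.choose_two_right]

theorem zeta_sub (m : ℕ) (a b : ℤ) : zeta m ^ (2 * b) - zeta m ^ (2 * a) =
    (zeta m ^ a * zeta m ^ b) *
      ((-2 * Complex.I) * Real.sin (Real.pi * ((a : ℝ) - (b : ℝ)) / m)) := by
  have h1 : zeta m ^ (2 * b) = (zeta m ^ a * zeta m ^ b) * zeta m ^ (-(a - b)) := by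
    rw [← zpow_add₀ (zeta_ne_zero m), ← zpow_add₀ (zeta_ne_zero m)]; congr 1; ring
  have h2 : zeta m ^ (2 * a) = (zeta m ^ a * zeta m ^ b) * zeta m ^ (a - b) := by
    rw [← zpow_add₀ (zeta_ne_zero m), ← zpow_add₀ (zeta_ne_zero m)]; congr 1; ring
  have h3 : Real.pi * ((-(a - b) : ℤ) : ℝ) / m = -(Real.pi * ((a : ℝ) - b) / m) := by
    push_cast; ring
  rw [h1, h2, zeta_zpow_eq m (-(a - b)), zeta_zpow_eq m (a - b), h3, Real.cos_neg, Real.sin_neg]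
  push_cast
  ring

/-- The momenta of the ground state. -/
def ground {m n : ℕ} (h : n ≤ m) : Fin n → Fin m := Fin.castLE h

/-- The ground momenta form an arithmetic progression, so a phase per column leaves a Vandermonde
matrix in `zeta m ^ (2 * x j)`. Those phases cancel the ones extracted from the differences. -/
theorem slater_ground {m n : ℕ} (h : n ≤ m) (x : Fin n → ℤ) :
    slater m (ground h) x = vdmConst n * sinProd m x := by
  cases n with
  | zero => simp [slater, vdmConst, sinProd]
  | succ n =>
  have h1 : slater m (ground h) x = (Matrix.of fun i j => zeta m ^ (-(n * x j)) *
      (Matrix.vandermonde fun j => zeta m ^ (2 * x j)).transpose i j).det := by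
    rw [slater]
    congr 1
    ext i j
    rw [Matrix.of_apply, Matrix.of_apply, Matrix.transpose_apply, Matrix.vandermonde_apply,
      ← zpow_natCast, ← zpow_mul, ← zpow_add₀ (zeta_ne_zero m)]
    congr 1
    simp only [mom, ground, Fin.val_castLE]
    push_cast
    ring
  have h2 : ∏ i, ∏ j ∈ Ioi i, (zeta m ^ (2 * x j) - zeta m ^ (2 * x i)) =
      (∏ i, ∏ j ∈ Ioi i, (zeta m ^ x i * zeta m ^ x j)) *
        (vdmConst (n + 1) * sinProd m x) := by
    simp_rw [zeta_sub, vdmConst, sinProd, Complex.ofReal_prod, ← Finset.prod_mul_distrib]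
  rw [h1, Matrix.det_mul_row, Matrix.det_transpose, Matrix.det_vandermonde, h2,
    prod_prod_Ioi_mul, ← mul_assoc, ← Finset.prod_mul_distrib, Finset.prod_eq_one, one_mul]
  intro i _
  rw [Nat.add_sub_cancel, ← zpow_natCast, ← zpow_mul, ← zpow_add₀ (zeta_ne_zero m),
    show -((n : ℤ) * x i) + x i * n = 0 by ring, zpow_zero]

/-- Since `chi * sinProd = |sinProd|`, the coefficient is a nonnegative multiple of the conjugate of
`vdmConst`. This settles the phase, leaving only the norm to compute. -/
theorem coef_ground_mul {m n : ℕ} (h : n ≤ m) :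
    coef m (ground h) * vdmConst n = ((2 ^ n.choose 2 * ‖coef m (ground h)‖ : ℝ) : ℂ) := by
  set B : ℝ := ∑ s : Fin n → Fin m, |sinProd m (fun i => (s i : ℤ))| with hB
  have hB0 : 0 ≤ B := Finset.sum_nonneg fun _ _ => abs_nonneg _
  have hf : (n.factorial : ℂ) ≠ 0 := by exact_mod_cast n.factorial_ne_zero
  have h1 : coef m (ground h) = star (vdmConst n) * ((B / n.factorial : ℝ) : ℂ) := by
    have h2 := factorial_mul_coef m (ground h)
    simp_rw [slater_ground, star_mul', Complex.star_def, Complex.conj_ofReal] at h2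
    push_cast
    rw [mul_div_assoc', eq_div_iff hf, mul_comm, h2, hB, Complex.ofReal_sum, Finset.mul_sum]
    refine Finset.sum_congr rfl fun s _ => ?_
    rw [← chi_mul_sinProd, Complex.star_def]
    push_cast
    ring
  have h3 : star (vdmConst n) * vdmConst n = ((2 ^ n.choose 2 * 2 ^ n.choose 2 : ℝ) : ℂ) := by
    rw [← norm_vdmConst, ← sq, Complex.star_def, Complex.conj_mul']
    push_cast
    rfl
  rw [h1, norm_mul, norm_star, norm_vdmConst, Complex.norm_real, Real.norm_of_nonneg (by positivity),
    mul_right_comm, h3]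
  push_cast
  ring

/-! ### Signed power sums: removing a pair of inverse momenta. -/

/-- The sum of `∏ z_i ^ s_i` over all `s` in `[0, m)ⁿ`, signed by `chi`. -/
noncomputable def signedSum (m : ℕ) {n : ℕ} (z : Fin n → ℂ) : ℂ :=
  ∑ s : Fin n → Fin m, (chi m (fun i => (s i : ℤ)) : ℂ) * ∏ i, z i ^ (s i : ℕ)

theorem sg_sub_fin {m : ℕ} (a b : Fin m) :
    sg m ((a : ℤ) - (b : ℤ)) = if b < a then 1 else if a < b then -1 else 0 := by
  have ha := a.2
  have hb := b.2
  split_ifs with h1 h2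
  · rw [Fin.lt_def] at h1
    exact sg_of_pos (by omega) (by omega)
  · rw [Fin.lt_def] at h2
    exact sg_of_neg (by omega) (by omega)
  · rw [Fin.lt_def] at h1 h2
    rw [show (a : ℤ) - b = 0 by omega, sg_zero]

/-- `(-1)` to the number of `j` with `s j ≥ t`. -/
def stair {m N : ℕ} (s : Fin N → Fin m) (t : ℕ) : ℝ :=
  ∏ j, if (s j : ℕ) < t then 1 else -1

/-- The sign of moving the `a`-th entry of `s` in front of the others. -/
noncomputable def sgAt {m N : ℕ} (s : Fin N → Fin m) (a : Fin N) : ℝ :=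
  ∏ j ∈ univ.erase a, sg m ((s a : ℤ) - (s j : ℤ))

/-- Away from the values of `s` the staircase is flat and equals the sign product; at a value its
two levels cancel. -/
theorem stair_add {m N : ℕ} (s : Fin N → Fin m) (hs : Function.Injective s) (t : Fin m) :
    stair s t + stair s (t + 1) = 2 * ∏ j, sg m ((t : ℤ) - (s j : ℤ)) := by
  by_cases h : ∃ a, s a = t
  · obtain ⟨a, rfl⟩ := h
    rw [Finset.prod_eq_zero (mem_univ a) (by rw [sub_self, sg_zero]), mul_zero, stair, stair,
      ← Finset.mul_prod_erase _ _ (mem_univ a), ← Finset.mul_prod_erase _ _ (mem_univ a)]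
    have : ∏ j ∈ univ.erase a, (if (s j : ℕ) < (s a : ℕ) + 1 then (1 : ℝ) else -1) =
        ∏ j ∈ univ.erase a, (if (s j : ℕ) < (s a : ℕ) then (1 : ℝ) else -1) := by
      refine Finset.prod_congr rfl fun j hj => ?_
      have hne : (s j : ℕ) ≠ s a := fun h => (ne_of_mem_erase hj) (hs (Fin.ext h))
      congr 1
      exact propext (by omega)
    rw [this]
    simp
  · push Not at h
    have h1 : stair s t = ∏ j, sg m ((t : ℤ) - (s j : ℤ)) := by
      refine Finset.prod_congr rfl fun j _ => ?_
      have hne : (s j : ℕ) ≠ t := fun h' => h j (Fin.ext h')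
      rw [sg_sub_fin]
      simp only [Fin.lt_def]
      split_ifs <;> first | rfl | omega
    have h2 : stair s (t + 1) = ∏ j, sg m ((t : ℤ) - (s j : ℤ)) := by
      refine Finset.prod_congr rfl fun j _ => ?_
      have hne : (s j : ℕ) ≠ t := fun h' => h j (Fin.ext h')
      rw [sg_sub_fin]
      simp only [Fin.lt_def]
      split_ifs <;> first | rfl | omega
    rw [h1, h2]
    ring

/-- The staircase jumps only at values of `s`, where exactly one factor passes from `-1` to `1`. -/
theorem stair_sub {m N : ℕ} (s : Fin N → Fin m) (hs : Function.Injective s) (t : Fin m) :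
    stair s (t + 1) - stair s t = 2 * ∑ a, if s a = t then sgAt s a else 0 := by
  by_cases h : ∃ a, s a = t
  · obtain ⟨a, rfl⟩ := h
    rw [Finset.sum_eq_single a (fun b _ hb => if_neg fun h => hb (hs h)) (by simp), if_pos rfl,
      stair, stair, ← Finset.mul_prod_erase _ _ (mem_univ a),
      ← Finset.mul_prod_erase _ _ (mem_univ a), sgAt]
    have h1 : ∏ j ∈ univ.erase a, (if (s j : ℕ) < (s a : ℕ) + 1 then (1 : ℝ) else -1) =
        ∏ j ∈ univ.erase a, sg m ((s a : ℤ) - (s j : ℤ)) := by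
      refine Finset.prod_congr rfl fun j hj => ?_
      have hne : (s j : ℕ) ≠ s a := fun h => (ne_of_mem_erase hj) (hs (Fin.ext h))
      rw [sg_sub_fin]
      simp only [Fin.lt_def]
      split_ifs <;> first | rfl | omega
    have h2 : ∏ j ∈ univ.erase a, (if (s j : ℕ) < (s a : ℕ) then (1 : ℝ) else -1) =
        ∏ j ∈ univ.erase a, sg m ((s a : ℤ) - (s j : ℤ)) := by
      refine Finset.prod_congr rfl fun j hj => ?_
      have hne : (s j : ℕ) ≠ s a := fun h => (ne_of_mem_erase hj) (hs (Fin.ext h))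
      rw [sg_sub_fin]
      simp only [Fin.lt_def]
      split_ifs <;> first | rfl | omega
    rw [h1, h2]
    simp
    ring
  · push Not at h
    rw [Finset.sum_eq_zero fun a _ => if_neg (h a), mul_zero, sub_eq_zero]
    refine Finset.prod_congr rfl fun j _ => ?_
    have hne : (s j : ℕ) ≠ t := fun h' => h j (Fin.ext h')
    congr 1
    exact propext (by omega)

/-- Summation by parts against `stair`. The boundary terms `stair s 0 = (-1)^N` and `stair s m * z^m
= z^m` cancel by `hz`. -/
theorem sum_sg_mul_pow {m N : ℕ} (s : Fin N → Fin m) (hs : Function.Injective s) {z : ℂ}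
    (hz : z ^ m = (-1) ^ N) :
    (1 - z) * ∑ t : Fin m, ((∏ j, sg m ((t : ℤ) - (s j : ℤ)) : ℝ) : ℂ) * z ^ (t : ℕ) =
      (1 + z) * ∑ a, (sgAt s a : ℂ) * z ^ (s a : ℕ) := by
  set A : ℂ := ∑ t : Fin m, (stair s t : ℂ) * z ^ (t : ℕ) with hA
  set B : ℂ := ∑ t : Fin m, (stair s (t + 1) : ℂ) * z ^ (t : ℕ) with hB
  have hAB : z * B = A := by
    have h0 : stair s 0 = (-1) ^ N := by simp [stair]
    have h1 : stair s m = 1 := Finset.prod_eq_one fun j _ => if_pos (s j).2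
    have h2 : z * B = ∑ t ∈ range m, (stair s (t + 1) : ℂ) * z ^ (t + 1) := by
      rw [hB, Fin.sum_univ_eq_sum_range (fun t => (stair s (t + 1) : ℂ) * z ^ t), Finset.mul_sum]
      exact Finset.sum_congr rfl fun t _ => by ring
    have h3 := Finset.sum_range_succ (fun t => (stair s t : ℂ) * z ^ t) m
    rw [Finset.sum_range_succ'] at h3
    rw [h2, hA, Fin.sum_univ_eq_sum_range (fun t => (stair s t : ℂ) * z ^ t)]
    rw [h0, h1, hz] at h3
    push_cast at h3
    linear_combination h3
  have hS : A + B = 2 * ∑ t : Fin m, ((∏ j, sg m ((t : ℤ) - (s j : ℤ)) : ℝ) : ℂ) * z ^ (t : ℕ) := by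
    rw [hA, hB, ← Finset.sum_add_distrib, Finset.mul_sum]
    refine Finset.sum_congr rfl fun t _ => ?_
    rw [← add_mul, ← Complex.ofReal_add, stair_add s hs]
    push_cast
    ring
  have hD : B - A = 2 * ∑ a, (sgAt s a : ℂ) * z ^ (s a : ℕ) := by
    have : ∀ a, (sgAt s a : ℂ) * z ^ (s a : ℕ) =
        ∑ t : Fin m, if s a = t then (sgAt s a : ℂ) * z ^ (t : ℕ) else 0 := fun a => by
      rw [Finset.sum_ite_eq]; simp
    simp_rw [this]
    rw [Finset.sum_comm, hA, hB, ← Finset.sum_sub_distrib, Finset.mul_sum]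
    refine Finset.sum_congr rfl fun t _ => ?_
    rw [← sub_mul, ← Complex.ofReal_sub, stair_sub s hs, Complex.ofReal_mul, Complex.ofReal_sum,
      mul_assoc, Finset.sum_mul]
    congr 1
    refine Finset.sum_congr rfl fun a _ => ?_
    split_ifs <;> simp
  linear_combination (-(1 - z) / 2) * hS + ((1 + z) / 2) * hD - hAB

theorem sgAt_comp_perm {m N : ℕ} (s : Fin N → Fin m) (σ : Equiv.Perm (Fin N)) (a : Fin N) :
    sgAt (s ∘ σ) a = sgAt s (σ a) := by
  refine Finset.prod_bij (fun j _ => σ j) ?_ ?_ ?_ ?_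
  · intro j hj
    simpa using hj
  · intro i _ j _ h
    exact σ.injective h
  · intro j hj
    refine ⟨σ.symm j, ?_, by simp⟩
    have := ne_of_mem_erase hj
    simpa [Equiv.symm_apply_eq] using this
  · intro j _
    rfl

theorem sum_cons {m n : ℕ} (F : (Fin (n + 1) → Fin m) → ℂ) :
    ∑ s, F s = ∑ t : Fin m, ∑ u : Fin n → Fin m, F (Fin.cons t u) := by
  rw [← (Fin.consEquiv fun _ : Fin (n + 1) => Fin m).sum_comp, Fintype.sum_prod_type]
  rfl

theorem chi_cons_fin {m n : ℕ} (t : Fin m) (u : Fin n → Fin m) :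
    chi m (fun i => ((Fin.cons t u : Fin (n + 1) → Fin m) i : ℤ)) =
      (∏ j, sg m ((t : ℤ) - (u j : ℤ))) * chi m (fun i => (u i : ℤ)) := by
  rw [← chi_cons m (t : ℤ) (fun i => (u i : ℤ))]
  congr 1
  ext i
  refine Fin.cases ?_ (fun i => ?_) i <;> simp

theorem chi_fin_eq_zero {m n : ℕ} (s : Fin n → Fin m) (hs : ¬ Function.Injective s) :
    chi m (fun i => (s i : ℤ)) = 0 := by
  simp only [Function.Injective, not_forall] at hs
  obtain ⟨a, b, hab, hne⟩ := hs
  have hm : m ≠ 0 := fun h => by subst h; exact (s a).elim0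
  exact chi_eq_zero hm fun h => hne (h (by simp [hab]))

/-- The part of `signedSum_succ_succ` that sums over the position of the second walker. -/
theorem sum_sgAt_mul_det {m n : ℕ} (w : ℂ) (z : Fin (n + 1) → ℂ)
    (hlast : w * z (Fin.last n) = 1)
    (hmid : ∀ i : Fin n, ∑ t : Fin m, (w * z i.castSucc) ^ (t : ℕ) = 0) :
    ∑ s : Fin (n + 1) → Fin m, (chi m (fun i => (s i : ℤ)) : ℂ) *
        (((sgAt s 0 : ℝ) : ℂ) * w ^ (s 0 : ℕ)) * (Matrix.of fun i j => z i ^ (s j : ℕ)).det =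
      (-1) ^ n * m * (n.factorial * signedSum m fun i => z i.castSucc) := by
  have h1 : ∀ (t : Fin m) (u : Fin n → Fin m),
      (chi m (fun i => ((Fin.cons t u : Fin (n + 1) → Fin m) i : ℤ)) : ℂ) *
        (((sgAt (Fin.cons t u : Fin (n + 1) → Fin m) 0 : ℝ) : ℂ) *
          w ^ ((Fin.cons t u : Fin (n + 1) → Fin m) 0 : ℕ)) *
        (Matrix.of fun i j => z i ^ ((Fin.cons t u : Fin (n + 1) → Fin m) j : ℕ)).det =
      (chi m (fun i => (u i : ℤ)) : ℂ) * (w ^ (t : ℕ) *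
        (Matrix.of fun i j => z i ^ ((Fin.cons t u : Fin (n + 1) → Fin m) j : ℕ)).det) := by
    intro t u
    by_cases h : ∃ j, u j = t
    · obtain ⟨j, rfl⟩ := h
      rw [Matrix.det_zero_of_column_eq (Fin.succ_ne_zero j).symm (fun i => by simp)]
      simp
    · push Not at h
      have h2 : sgAt (Fin.cons t u : Fin (n + 1) → Fin m) 0 =
          ∏ j, sg m ((t : ℤ) - (u j : ℤ)) := by
        rw [sgAt, Fin.univ_succ, Finset.erase_cons, Finset.prod_map]
        simp
      -- The sign of `t` against `u` occurs in both `chi` and `sgAt`, and squares to one.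
      have h3 : (∏ j, sg m ((t : ℤ) - (u j : ℤ))) * (∏ j, sg m ((t : ℤ) - (u j : ℤ))) = 1 := by
        rw [← Finset.prod_mul_distrib]
        refine Finset.prod_eq_one fun j _ => ?_
        rw [sg_sub_fin]
        have := h j
        split_ifs with h4 h5
        · norm_num
        · norm_num
        · exact absurd (le_antisymm (not_lt.1 h5) (not_lt.1 h4)) this
      rw [chi_cons_fin, h2]
      have h3' := congrArg (fun r : ℝ => (r : ℂ)) h3
      simp only [Complex.ofReal_mul, Complex.ofReal_one, Fin.cons_zero] at h3' ⊢
      linear_combination ((chi m (fun i => (u i : ℤ)) : ℂ) * (w ^ (t : ℕ) *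
        (Matrix.of fun i j => z i ^ ((Fin.cons t u : Fin (n + 1) → Fin m) j : ℕ)).det)) * h3'
  rw [sum_cons]
  simp_rw [h1]
  rw [Finset.sum_comm, signedSum, factorial_mul_sum _ (chi_comp_perm_cast m)
    (fun i (t : Fin m) => z i.castSucc ^ (t : ℕ)), Finset.mul_sum]
  refine Finset.sum_congr rfl fun u _ => ?_
  rw [← Finset.mul_sum]
  -- Expand along the first column and sum over `t`: `hmid` kills every row but the last, where
  -- `hlast` gives `m`.
  have h4 : ∑ t : Fin m, w ^ (t : ℕ) *
      (Matrix.of fun i j => z i ^ ((Fin.cons t u : Fin (n + 1) → Fin m) j : ℕ)).det =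
      (-1) ^ n * m * (Matrix.of fun i j => z (Fin.castSucc i) ^ (u j : ℕ)).det := by
    simp_rw [Matrix.det_succ_column_zero, Finset.mul_sum]
    rw [Finset.sum_comm, Fin.sum_univ_castSucc, Finset.sum_eq_zero, zero_add]
    · have h5 : ∀ t : Fin m, w ^ (t : ℕ) * z (Fin.last n) ^ (t : ℕ) = 1 := fun t => by
        rw [← mul_pow, hlast, one_pow]
      have h6 : ∀ t : Fin m, (Matrix.of fun i j =>
          z i ^ ((Fin.cons t u : Fin (n + 1) → Fin m) j : ℕ)).submatrix (Fin.last n).succAbove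
            Fin.succ = Matrix.of fun i j => z (Fin.castSucc i) ^ (u j : ℕ) := fun t => by
        ext i j
        simp
      simp_rw [h6]
      rw [Finset.sum_congr rfl fun t _ => show _ = (-1 : ℂ) ^ n *
        (Matrix.of fun i j => z (Fin.castSucc i) ^ (u j : ℕ)).det by
          simp only [Matrix.of_apply, Fin.cons_zero, Fin.val_last]
          linear_combination ((-1 : ℂ) ^ n *
            (Matrix.of fun i j => z (Fin.castSucc i) ^ (u j : ℕ)).det) * h5 t]
      simp
      ring
    · intro i _
      have h7 : ∀ t : Fin m, (Matrix.of fun i j =>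
          z i ^ ((Fin.cons t u : Fin (n + 1) → Fin m) j : ℕ)).submatrix
            (Fin.castSucc i).succAbove Fin.succ =
          Matrix.of fun k j => z ((Fin.castSucc i).succAbove k) ^ (u j : ℕ) := fun t => by
        ext k j
        simp
      simp_rw [h7]
      calc _ = ∑ t : Fin m, ((-1 : ℂ) ^ (i : ℕ) *
            (Matrix.of fun k j => z ((Fin.castSucc i).succAbove k) ^ (u j : ℕ)).det) *
              (w * z i.castSucc) ^ (t : ℕ) := Finset.sum_congr rfl fun t _ => by
            simp only [Matrix.of_apply, Fin.cons_zero, Fin.val_castSucc, mul_pow]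
            ring
        _ = 0 := by rw [← Finset.mul_sum, hmid, mul_zero]
  rw [h4]
  ring

/-- Pairing the first momentum with the last one, which is its inverse. -/
theorem signedSum_succ_succ {m n : ℕ} (w : ℂ) (z : Fin (n + 1) → ℂ)
    (hw : w ^ m = (-1) ^ (n + 1)) (hlast : w * z (Fin.last n) = 1)
    (hmid : ∀ i : Fin n, ∑ t : Fin m, (w * z i.castSucc) ^ (t : ℕ) = 0) :
    (1 - w) * signedSum m (Fin.cons w z : Fin (n + 2) → ℂ) =
      (1 + w) * ((-1) ^ n * m * signedSum m fun i => z i.castSucc) := by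
  set h : (Fin (n + 1) → Fin m) → ℂ := fun s => ∑ a, (sgAt s a : ℂ) * w ^ (s a : ℕ) with hh
  have hperm : ∀ (s : Fin (n + 1) → Fin m) (σ : Equiv.Perm (Fin (n + 1))), h (s ∘ σ) = h s := by
    intro s σ
    simp only [hh, sgAt_comp_perm]
    exact Equiv.sum_comp σ fun a => (sgAt s a : ℂ) * w ^ (s a : ℕ)
  -- Sum out the coordinate that carries `w`; the power of `w` is then attached to one of the other
  -- positions.
  have h1 : (1 - w) * signedSum m (Fin.cons w z : Fin (n + 2) → ℂ) =
      (1 + w) * ∑ s : Fin (n + 1) → Fin m, (chi m (fun i => (s i : ℤ)) : ℂ) * h s *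
        ∏ i, z i ^ (s i : ℕ) := by
    rw [signedSum, sum_cons, Finset.sum_comm, Finset.mul_sum, Finset.mul_sum]
    refine Finset.sum_congr rfl fun s _ => ?_
    simp_rw [chi_cons_fin, Fin.prod_univ_succ (n := n + 1), Fin.cons_zero, Fin.cons_succ]
    by_cases hs : Function.Injective s
    · have h2 := sum_sg_mul_pow s hs hw
      rw [Finset.mul_sum] at h2 ⊢
      rw [show ∀ a b c d : ℂ, a * (b * c * d) = (a * c) * (b * d) by intros; ring, ← h2,
        Finset.sum_mul]
      refine Finset.sum_congr rfl fun t _ => ?_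
      push_cast
      ring
    · rw [chi_fin_eq_zero s hs]
      simp
  have h3 := factorial_mul_sum (fun s : Fin (n + 1) → Fin m =>
    (chi m (fun i => (s i : ℤ)) : ℂ) * h s)
    (fun s σ => by rw [hperm, chi_comp_perm_cast]; ring) (fun i (t : Fin m) => z i ^ (t : ℕ))
  have h4 : ∑ s : Fin (n + 1) → Fin m, (chi m (fun i => (s i : ℤ)) : ℂ) * h s *
      (Matrix.of fun i j => z i ^ (s j : ℕ)).det =
      (n + 1 : ℕ) * ((-1) ^ n * m * (n.factorial * signedSum m fun i => z i.castSucc)) := by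
    rw [← sum_sgAt_mul_det w z hlast hmid]
    simp_rw [hh, Finset.mul_sum, Finset.sum_mul]
    rw [Finset.sum_comm]
    -- A transposition moves position `a` to `0`; the signs of `chi` and of the determinant cancel,
    -- so all positions contribute equally.
    have h5 : ∀ a : Fin (n + 1), ∑ s : Fin (n + 1) → Fin m, (chi m (fun i => (s i : ℤ)) : ℂ) *
        (((sgAt s a : ℝ) : ℂ) * w ^ (s a : ℕ)) * (Matrix.of fun i j => z i ^ (s j : ℕ)).det =
        ∑ s : Fin (n + 1) → Fin m, (chi m (fun i => (s i : ℤ)) : ℂ) *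
        (((sgAt s 0 : ℝ) : ℂ) * w ^ (s 0 : ℕ)) * (Matrix.of fun i j => z i ^ (s j : ℕ)).det := by
      intro a
      rw [← sum_comp_perm (Equiv.swap 0 a)]
      refine Finset.sum_congr rfl fun s _ => ?_
      rw [chi_comp_perm_cast, sgAt_comp_perm, Equiv.swap_apply_right, Function.comp_apply,
        Equiv.swap_apply_right]
      have h6 : (Matrix.of fun i j => z i ^ ((s ∘ Equiv.swap 0 a) j : ℕ)).det =
          ((Equiv.Perm.sign (Equiv.swap 0 a) : ℤˣ) : ℤ) *
            (Matrix.of fun i j => z i ^ (s j : ℕ)).det := by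
        rw [← Matrix.det_permute']
        rfl
      rw [h6]
      linear_combination ((chi m (fun i => (s i : ℤ)) : ℂ) *
        (((sgAt s 0 : ℝ) : ℂ) * w ^ (s 0 : ℕ)) * (Matrix.of fun i j => z i ^ (s j : ℕ)).det) *
          sign_mul_sign (Equiv.swap 0 a)
    simp_rw [h5]
    rw [Finset.sum_const, Finset.card_univ, Fintype.card_fin, nsmul_eq_mul, Finset.mul_sum]
  have hf : ((n + 1).factorial : ℂ) ≠ 0 := by exact_mod_cast (n + 1).factorial_ne_zero
  rw [h4] at h3
  apply mul_left_cancel₀ hf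
  rw [h1, mul_left_comm, h3, Nat.factorial_succ]
  push_cast
  ring

theorem signedSum_zero (m : ℕ) (z : Fin 0 → ℂ) : signedSum m z = 1 := by
  simp [signedSum, chi]

theorem signedSum_one (m : ℕ) (z : Fin 1 → ℂ) :
    signedSum m z = ∑ t : Fin m, z 0 ^ (t : ℕ) := by
  rw [signedSum, sum_cons]
  simp [chi]

/-! ### Evaluation of the two extremal coefficients. -/

/-- The momenta of the ground state, multiplied by `a`. -/
noncomputable def twisted (m n : ℕ) (a : ℂ) (i : Fin n) : ℂ := a * zeta m ^ (-mom n (i : ℕ))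

theorem one_add_zeta_two_mul (m : ℕ) (e : ℤ) : 1 + zeta m ^ e =
    2 * Real.cos (Real.pi * e / (2 * m)) * Complex.exp ((Real.pi * e / (2 * m) : ℝ) * Complex.I) := by
  have h : zeta m ^ e = Complex.exp ((Real.pi * e / (2 * m) : ℝ) * Complex.I) ^ 2 := by
    rw [zeta_zpow, ← Complex.exp_nat_mul]
    congr 1
    push_cast
    field_simp
  have h2 := Complex.cos_sq_add_sin_sq (Real.pi * e / (2 * m) : ℝ)
  rw [h, Complex.exp_mul_I]
  push_cast at h2 ⊢
  linear_combination -h2 + (Complex.sin (Real.pi * e / (2 * m))) ^ 2 * Complex.I_sq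

theorem one_sub_zeta_two_mul (m : ℕ) (e : ℤ) : 1 - zeta m ^ e =
    -2 * Complex.I * Real.sin (Real.pi * e / (2 * m)) *
      Complex.exp ((Real.pi * e / (2 * m) : ℝ) * Complex.I) := by
  have h : zeta m ^ e = Complex.exp ((Real.pi * e / (2 * m) : ℝ) * Complex.I) ^ 2 := by
    rw [zeta_zpow, ← Complex.exp_nat_mul]
    congr 1
    push_cast
    field_simp
  have h2 := Complex.cos_sq_add_sin_sq (Real.pi * e / (2 * m) : ℝ)
  rw [h, Complex.exp_mul_I]
  push_cast at h2 ⊢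
  linear_combination -h2 + (Complex.sin (Real.pi * e / (2 * m))) ^ 2 * Complex.I_sq

/-- Deleting the two outermost of `n + 2` symmetric momenta leaves exactly the momenta of `n`
walkers. -/
theorem signedSum_twisted {m n : ℕ} (hn : n + 2 ≤ m) {a : ℂ} (ha : a * a = 1) (ham : a ^ m = 1) :
    (1 - a * zeta m ^ ((n + 1 : ℕ) : ℤ)) * signedSum m (twisted m (n + 2) a) =
      (1 + a * zeta m ^ ((n + 1 : ℕ) : ℤ)) * ((-1) ^ n * m * signedSum m (twisted m n a)) := by
  have hm : m ≠ 0 := by omega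
  have hA : (Fin.cons (a * zeta m ^ ((n + 1 : ℕ) : ℤ))
      (fun i : Fin (n + 1) => twisted m (n + 2) a i.succ) : Fin (n + 2) → ℂ) =
      twisted m (n + 2) a := by
    ext i
    refine Fin.cases ?_ (fun i => ?_) i
    · rw [Fin.cons_zero, twisted, mom]
      congr 2
      simp
      ring
    · rw [Fin.cons_succ]
  have hB : (fun i : Fin n => twisted m (n + 2) a i.castSucc.succ) = twisted m n a := by
    ext i
    rw [twisted, twisted]
    congr 3
    simp only [mom, Fin.val_succ, Fin.val_castSucc]
    push_cast
    ring
  rw [← hA, ← hB]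
  apply signedSum_succ_succ
  · rw [mul_pow, ham, one_mul, ← zpow_natCast, ← zpow_mul, mul_comm, zeta_zpow_mul hm,
      zpow_natCast]
  · rw [twisted, mul_mul_mul_comm, ha, one_mul, ← zpow_add₀ (zeta_ne_zero m), mom]
    rw [show ((n + 1 : ℕ) : ℤ) + -(2 * (((Fin.last n).succ : Fin (n + 2)) : ℕ) -
      (((n + 2 : ℕ) : ℤ) - 1)) = 0 by simp; ring, zpow_zero]
  · intro i
    have h1 : a * zeta m ^ ((n + 1 : ℕ) : ℤ) * twisted m (n + 2) a (Fin.succ (Fin.castSucc i)) =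
        zeta m ^ (2 * ((n : ℤ) - i)) := by
      rw [twisted, mul_mul_mul_comm, ha, one_mul, ← zpow_add₀ (zeta_ne_zero m), mom]
      congr 1
      simp only [Fin.val_succ, Fin.val_castSucc]
      push_cast
      ring
    have hi := i.2
    simp_rw [h1]
    -- Here `1 ≤ n - i ≤ n < m`, so the geometric sum runs over a nontrivial root of unity.
    rw [sum_zeta hm, if_neg]
    intro hd
    have := Int.le_of_dvd (by omega) hd
    omega

theorem half_angle_pos {m n : ℕ} (hn : n + 2 ≤ m) : 0 < Real.pi * ((n + 1 : ℕ) : ℤ) / (2 * m) := by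
  have hm : (0 : ℝ) < m := by exact_mod_cast (by omega : 0 < m)
  have := Real.pi_pos
  push_cast
  positivity

theorem half_angle_lt {m n : ℕ} (hn : n + 2 ≤ m) :
    Real.pi * ((n + 1 : ℕ) : ℤ) / (2 * m) < Real.pi / 2 := by
  have hm : (0 : ℝ) < m := by exact_mod_cast (by omega : 0 < m)
  have h1 : ((n + 1 : ℕ) : ℝ) < m := by exact_mod_cast (by omega : n + 1 < m)
  have := Real.pi_pos
  rw [div_lt_div_iff₀ (by positivity) (by norm_num)]
  have := mul_lt_mul_of_pos_left h1 this
  push_cast at this ⊢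
  linarith

/-- The half-angle identity `(1 + e^{iθ}) / (1 - e^{iθ}) = i cot (θ/2)` with `θ = π (n + 1) / m`. -/
theorem signedSum_twisted_one {m n : ℕ} (hn : n + 2 ≤ m) :
    signedSum m (twisted m (n + 2) 1) =
      Complex.I * (-1) ^ n * m * (Real.cot (Real.pi * ((n + 1 : ℕ) : ℤ) / (2 * m)) : ℝ) *
        signedSum m (twisted m n 1) := by
  have h := signedSum_twisted hn (a := 1) (by norm_num) (by simp)
  have hs : (Real.sin (Real.pi * ((n + 1 : ℕ) : ℤ) / (2 * m)) : ℂ) ≠ 0 := by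
    exact_mod_cast (Real.sin_pos_of_pos_of_lt_pi (half_angle_pos hn)
      ((half_angle_lt hn).trans (by linarith [Real.pi_pos]))).ne'
  rw [one_mul, one_add_zeta_two_mul, one_sub_zeta_two_mul] at h
  have he := Complex.exp_ne_zero ((Real.pi * ((n + 1 : ℕ) : ℤ) / (2 * m) : ℝ) * Complex.I)
  rw [Real.cot_eq_cos_div_sin]
  set E := Complex.exp ((Real.pi * ((n + 1 : ℕ) : ℤ) / (2 * m) : ℝ) * Complex.I)
  set S := Real.sin (Real.pi * ((n + 1 : ℕ) : ℤ) / (2 * m))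
  set C := Real.cos (Real.pi * ((n + 1 : ℕ) : ℤ) / (2 * m))
  set X := signedSum m (twisted m (n + 2) 1)
  set Y := signedSum m (twisted m n 1)
  have h2 : (E * 2) * (S * X) = (E * 2) * (Complex.I * (-1) ^ n * m * C * Y) := by
    linear_combination Complex.I * h + 2 * S * E * X * Complex.I_sq
  have h3 := mul_left_cancel₀ (mul_ne_zero he two_ne_zero) h2
  push_cast
  field_simp
  linear_combination h3

/-- The sign `a = -1` inverts the quotient, turning `i cot` into `-i tan`; evenness of `m` is the
condition `a ^ m = 1`. -/
theorem signedSum_twisted_neg_one {m n : ℕ} (hn : n + 2 ≤ m) (hm : Even m) :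
    signedSum m (twisted m (n + 2) (-1)) =
      -Complex.I * (-1) ^ n * m * (Real.tan (Real.pi * ((n + 1 : ℕ) : ℤ) / (2 * m)) : ℝ) *
        signedSum m (twisted m n (-1)) := by
  have h := signedSum_twisted hn (a := -1) (by norm_num) hm.neg_one_pow
  have hs : (Real.cos (Real.pi * ((n + 1 : ℕ) : ℤ) / (2 * m)) : ℂ) ≠ 0 := by
    exact_mod_cast (Real.cos_pos_of_mem_Ioo ⟨by
      linarith [half_angle_pos hn, Real.pi_pos], half_angle_lt hn⟩).ne'
  rw [neg_one_mul, sub_neg_eq_add, ← sub_eq_add_neg, one_add_zeta_two_mul,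
    one_sub_zeta_two_mul] at h
  have he := Complex.exp_ne_zero ((Real.pi * ((n + 1 : ℕ) : ℤ) / (2 * m) : ℝ) * Complex.I)
  rw [Real.tan_eq_sin_div_cos]
  set E := Complex.exp ((Real.pi * ((n + 1 : ℕ) : ℤ) / (2 * m) : ℝ) * Complex.I)
  set S := Real.sin (Real.pi * ((n + 1 : ℕ) : ℤ) / (2 * m))
  set C := Real.cos (Real.pi * ((n + 1 : ℕ) : ℤ) / (2 * m))
  set X := signedSum m (twisted m (n + 2) (-1))
  set Y := signedSum m (twisted m n (-1))
  have h2 : (E * 2) * (C * X) = (E * 2) * (-Complex.I * (-1) ^ n * m * S * Y) := by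
    linear_combination h
  have h3 := mul_left_cancel₀ (mul_ne_zero he two_ne_zero) h2
  push_cast
  field_simp
  linear_combination h3

/-- The angle of the `h`-th factor for an even number of walkers. -/
noncomputable def evenAngle (m h : ℕ) : ℝ := (2 * (h : ℝ) - 1) * Real.pi / (2 * m)

theorem signedSum_one_even {m r : ℕ} (hr : 2 * r ≤ m) :
    signedSum m (twisted m (2 * r) 1) =
      (Complex.I * m) ^ r * ((∏ h ∈ Icc 1 r, Real.cot (evenAngle m h) : ℝ) : ℂ) := by
  induction r with
  | zero => rw [Finset.Icc_eq_empty (by simp), Finset.prod_empty]; simp [signedSum_zero]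
  | succ r ih =>
    rw [show 2 * (r + 1) = 2 * r + 2 by ring, signedSum_twisted_one (by omega), ih (by omega),
      Finset.prod_Icc_succ_top (by omega), (even_two_mul r).neg_one_pow, evenAngle.eq_1 m (r + 1),
      show Real.pi * ((2 * r + 1 : ℕ) : ℤ) / (2 * m) =
        (2 * ((r + 1 : ℕ) : ℝ) - 1) * Real.pi / (2 * m) by push_cast; ring]
    push_cast
    ring

theorem signedSum_neg_one_even {m r : ℕ} (hr : 2 * r ≤ m) (hm : Even m) :
    signedSum m (twisted m (2 * r) (-1)) =
      (-Complex.I * m) ^ r * ((∏ h ∈ Icc 1 r, Real.tan (evenAngle m h) : ℝ) : ℂ) := by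
  induction r with
  | zero => rw [Finset.Icc_eq_empty (by simp), Finset.prod_empty]; simp [signedSum_zero]
  | succ r ih =>
    rw [show 2 * (r + 1) = 2 * r + 2 by ring, signedSum_twisted_neg_one (by omega) hm,
      ih (by omega), Finset.prod_Icc_succ_top (by omega), (even_two_mul r).neg_one_pow,
      evenAngle.eq_1 m (r + 1), show Real.pi * ((2 * r + 1 : ℕ) : ℤ) / (2 * m) =
        (2 * ((r + 1 : ℕ) : ℝ) - 1) * Real.pi / (2 * m) by push_cast; ring]
    push_cast
    ring

theorem signedSum_one_odd {m r : ℕ} (hr : 2 * r + 1 ≤ m) :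
    signedSum m (twisted m (2 * r + 1) 1) =
      (-Complex.I * m) ^ r * m * ((∏ h ∈ Icc 1 r, Real.cot ((h : ℝ) * Real.pi / m) : ℝ) : ℂ) := by
  induction r with
  | zero =>
    rw [Finset.Icc_eq_empty (by simp), Finset.prod_empty, signedSum_one]
    simp [twisted, mom]
  | succ r ih =>
    have hm : (m : ℝ) ≠ 0 := by exact_mod_cast (by omega : m ≠ 0)
    rw [show 2 * (r + 1) + 1 = 2 * r + 1 + 2 by ring, signedSum_twisted_one (by omega),
      ih (by omega), Finset.prod_Icc_succ_top (by omega), (odd_two_mul_add_one r).neg_one_pow,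
      show Real.pi * ((2 * r + 1 + 1 : ℕ) : ℤ) / (2 * m) =
        ((r + 1 : ℕ) : ℝ) * Real.pi / m by push_cast; field_simp; ring]
    push_cast
    ring

/-- The last unpaired momentum leaves an alternating sum of even length, which is zero. -/
theorem signedSum_neg_one_odd {m r : ℕ} (hr : 2 * r + 1 ≤ m) (hm : Even m) :
    signedSum m (twisted m (2 * r + 1) (-1)) = 0 := by
  induction r with
  | zero =>
    rw [signedSum_one]
    simp only [twisted, mom]
    rw [Fin.sum_univ_eq_sum_range
      (fun t => (-1 * zeta m ^ (-(2 * ((0 : Fin 1) : ℕ) - ((1 : ℕ) - 1 : ℤ)))) ^ t)]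
    simp [neg_one_geom_sum, hm]
  | succ r ih =>
    rw [show 2 * (r + 1) + 1 = 2 * r + 1 + 2 by ring, signedSum_twisted_neg_one (by omega) hm,
      ih (by omega), mul_zero]

/-! ### The extremal eigenvalues. -/

theorem ground_injective {m n : ℕ} (h : n ≤ m) : Function.Injective (ground h) :=
  Fin.castLE_injective h

/-- Bathtub principle: distinct indices collect at most the total of the positive parts of `g - c`,
and `ground` collects exactly that total. -/
theorem sum_le_of_threshold {m n : ℕ} (h : n ≤ m) (g : Fin m → ℝ) (c : ℝ)
    (h1 : ∀ j : Fin m, (j : ℕ) < n → c ≤ g j) (h2 : ∀ j : Fin m, n ≤ (j : ℕ) → g j ≤ c)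
    {p : Fin n → Fin m} (hp : Function.Injective p) :
    ∑ i, g (p i) ≤ ∑ i, g (ground h i) ∧
      ((∃ i, g (p i) < c) → ∑ i, g (p i) < ∑ i, g (ground h i)) := by
  have hA : ∑ i, max (g (p i) - c) 0 ≤ ∑ j : Fin m, max (g j - c) 0 := by
    rw [← Finset.sum_image (f := fun j => max (g j - c) 0) (fun a _ b _ hab => hp hab)]
    exact Finset.sum_le_univ_sum_of_nonneg fun _ => le_max_right _ _
  have hB : ∑ j : Fin m, max (g j - c) 0 = ∑ i, (g (ground h i) - c) := by
    have h3 : ∑ i, (g (ground h i) - c) = ∑ i, max (g (ground h i) - c) 0 :=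
      Finset.sum_congr rfl fun i _ => (max_eq_left (sub_nonneg.2 (h1 _ i.2))).symm
    rw [h3, ← Finset.sum_image (f := fun j => max (g j - c) 0)
      (fun a _ b _ hab => ground_injective h hab)]
    symm
    apply Finset.sum_subset (Finset.subset_univ _)
    intro j _ hj
    apply max_eq_right
    rw [sub_nonpos]
    apply h2
    by_contra hc
    exact hj (Finset.mem_image.2 ⟨⟨j, by omega⟩, mem_univ _, rfl⟩)
  simp only [Finset.sum_sub_distrib, Finset.sum_const] at hB
  have hC : ∀ i ∈ univ, g (p i) - c ≤ max (g (p i) - c) 0 := fun i _ => le_max_left _ _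
  constructor
  · have := Finset.sum_le_sum hC
    simp only [Finset.sum_sub_distrib, Finset.sum_const] at this
    linarith
  · rintro ⟨i, hi⟩
    have := Finset.sum_lt_sum hC ⟨i, mem_univ i, by rw [lt_max_iff]; right; linarith⟩
    simp only [Finset.sum_sub_distrib, Finset.sum_const] at this
    linarith

/-- The largest eigenvalue of the step operator for `n` walkers. -/
noncomputable def topEig (m n : ℕ) : ℝ :=
  2 * (Real.sin (n * Real.pi / m) / Real.sin (Real.pi / m))

theorem sin_pi_div_pos {m : ℕ} (hm : 2 ≤ m) : 0 < Real.sin (Real.pi / m) := by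
  have := sin_pos_of_range (m := m) (d := 1) one_pos (by omega)
  simpa using this

/-- The sum telescopes after multiplication by `sin (π / m)`. The offset `δ = 0` gives the top
eigenvalue, `δ = 1` the bound below it for odd `m`. -/
theorem sum_cos_ground {m : ℕ} (hm : 2 ≤ m) (n : ℕ) (δ : ℝ) :
    ∑ i : Fin n, 2 * Real.cos (Real.pi * (mom n (i : ℕ) + δ) / m) =
      topEig m n * Real.cos (Real.pi * δ / m) := by
  have hs := (sin_pi_div_pos hm).ne'
  have h1 : ∀ i : ℕ, 2 * Real.cos (Real.pi * (mom n i + δ) / m) * Real.sin (Real.pi / m) =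
      Real.sin (Real.pi * (2 * (i + 1 : ℕ) - n + δ) / m) -
        Real.sin (Real.pi * (2 * (i : ℕ) - n + δ) / m) := fun i => by
    rw [Real.sin_sub_sin]
    rw [show (Real.pi * (2 * (i + 1 : ℕ) - n + δ) / m - Real.pi * (2 * (i : ℕ) - n + δ) / m) / 2 =
      Real.pi / m by push_cast; ring, show (Real.pi * (2 * (i + 1 : ℕ) - n + δ) / m +
      Real.pi * (2 * (i : ℕ) - n + δ) / m) / 2 = Real.pi * (mom n i + δ) / m by
        rw [mom]; push_cast; ring]
    ring
  apply mul_right_cancel₀ hs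
  rw [Finset.sum_mul]
  simp_rw [h1]
  rw [Fin.sum_univ_eq_sum_range (fun i => Real.sin (Real.pi * (2 * (i + 1 : ℕ) - n + δ) / m) -
        Real.sin (Real.pi * (2 * (i : ℕ) - n + δ) / m)),
    Finset.sum_range_sub (fun i : ℕ => Real.sin (Real.pi * (2 * (i : ℕ) - n + δ) / m)), topEig,
    Real.sin_sub_sin]
  rw [show (Real.pi * (2 * (n : ℕ) - n + δ) / m - Real.pi * (2 * (0 : ℕ) - n + δ) / m) / 2 =
      n * Real.pi / m by push_cast; ring, show (Real.pi * (2 * (n : ℕ) - n + δ) / m +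
      Real.pi * (2 * (0 : ℕ) - n + δ) / m) / 2 = Real.pi * δ / m by push_cast; ring]
  field_simp

/-- The cut at `n` separates the last occupied exponent `n - 1` from the first free one, `n + 1`. -/
theorem cos_threshold_le {m : ℕ} (hm : 2 ≤ m) {n : ℕ} {e : ℤ} (h1 : -n ≤ e) (h2 : e ≤ n)
    (hn : n ≤ m) : Real.cos (Real.pi * n / m) ≤ Real.cos (Real.pi * e / m) := by
  have hm' : (0 : ℝ) < m := by exact_mod_cast (by omega : 0 < m)
  rw [← Real.cos_abs (Real.pi * e / m)]
  have h3 : |Real.pi * e / m| = Real.pi * (|e| : ℤ) / m := by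
    rw [abs_div, abs_mul, abs_of_pos Real.pi_pos, abs_of_pos hm', Int.cast_abs]
  rw [h3]
  have h4 : ((|e| : ℤ) : ℝ) ≤ n := by exact_mod_cast abs_le.2 ⟨h1, h2⟩
  have h5 : (0 : ℝ) ≤ ((|e| : ℤ) : ℝ) := by exact_mod_cast abs_nonneg e
  have h6 : (n : ℝ) ≤ m := by exact_mod_cast hn
  apply Real.cos_le_cos_of_nonneg_of_le_pi
  · have := Real.pi_pos; positivity
  · rw [div_le_iff₀ hm']; exact mul_le_mul_of_nonneg_left h6 Real.pi_pos.le
  · have := Real.pi_pos; gcongr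

theorem cos_lt_threshold {m : ℕ} {n : ℕ} {e : ℤ} (h1 : (n : ℤ) < e) (h2 : e < 2 * m - n) :
    Real.cos (Real.pi * e / m) < Real.cos (Real.pi * n / m) := by
  have hm' : (0 : ℝ) < m := by exact_mod_cast (by omega : 0 < m)
  have key : ∀ e : ℤ, (n : ℤ) < e → e ≤ m →
      Real.cos (Real.pi * e / m) < Real.cos (Real.pi * n / m) := fun e h3 h4 => by
    have h3' : (n : ℝ) < e := by exact_mod_cast h3
    have h4' : (e : ℝ) ≤ m := by exact_mod_cast h4
    have := Real.pi_pos
    apply Real.cos_lt_cos_of_nonneg_of_le_pi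
    · positivity
    · rw [div_le_iff₀ hm']; exact mul_le_mul_of_nonneg_left h4' Real.pi_pos.le
    · gcongr
  rcases le_or_gt e m with h | h
  · exact key e h1 h
  · have h5 := key (2 * m - e) (by omega) (by omega)
    rwa [show Real.pi * ((2 * m - e : ℤ) : ℝ) / m = 2 * Real.pi - Real.pi * e / m by
      push_cast; field_simp, Real.cos_two_pi_sub] at h5

theorem cos_le_threshold {m : ℕ} (hm : 2 ≤ m) {n : ℕ} {e : ℤ} (h1 : (n : ℤ) < e)
    (h2 : e ≤ 2 * m - n) : Real.cos (Real.pi * e / m) ≤ Real.cos (Real.pi * n / m) := by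
  rcases h2.lt_or_eq with h | h
  · exact (cos_lt_threshold h1 h).le
  · have hm' : (0 : ℝ) < m := by exact_mod_cast (by omega : 0 < m)
    rw [h, show Real.pi * ((2 * m - n : ℤ) : ℝ) / m = 2 * Real.pi - Real.pi * n / m by
      push_cast; field_simp, Real.cos_two_pi_sub]

theorem exists_perm_of_lt {m n : ℕ} (h : n ≤ m) {p : Fin n → Fin m} (hp : Function.Injective p)
    (hlt : ∀ i, (p i : ℕ) < n) : ∃ σ : Equiv.Perm (Fin n), p = ground h ∘ σ := by
  have hinj : Function.Injective fun i => (⟨p i, hlt i⟩ : Fin n) := fun a b hab =>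
    hp (Fin.ext (by simpa using hab))
  exact ⟨Equiv.ofBijective _ (Finite.injective_iff_bijective.1 hinj), rfl⟩

theorem eig_ground {m n : ℕ} (hm : 2 ≤ m) (h : n ≤ m) : eig m (ground h) = topEig m n := by
  have := sum_cos_ground hm n 0
  simpa [eig, ground] using this

theorem eig_le {m n : ℕ} (hm : 2 ≤ m) (h : n ≤ m) {p : Fin n → Fin m}
    (hp : Function.Injective p) : eig m p ≤ topEig m n ∧
      (eig m p = topEig m n → ∃ σ : Equiv.Perm (Fin n), p = ground h ∘ σ) := by
  have H := sum_le_of_threshold h (fun j : Fin m => 2 * Real.cos (Real.pi * mom n (j : ℕ) / m))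
    (2 * Real.cos (Real.pi * n / m))
    (fun j hj => by
      have := cos_threshold_le hm (n := n) (e := mom n (j : ℕ)) (by rw [mom]; omega)
        (by rw [mom]; omega) h
      linarith)
    (fun j hj => by
      have := cos_lt_threshold (m := m) (n := n) (e := mom n (j : ℕ)) (by rw [mom]; omega)
        (by rw [mom]; omega)
      linarith) hp
  have hg : ∑ i, 2 * Real.cos (Real.pi * mom n (ground h i : ℕ) / m) = topEig m n :=
    eig_ground hm h
  rw [hg] at H
  refine ⟨H.1, fun heq => exists_perm_of_lt h hp ?_⟩
  by_contra! hc
  obtain ⟨i, hi⟩ := hc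
  refine (H.2 ⟨i, ?_⟩).ne heq
  have := cos_lt_threshold (m := m) (n := n) (e := mom n (p i : ℕ)) (by rw [mom]; omega)
    (by rw [mom]; omega)
  linarith

/-- Translation of a momentum by half a period. -/
def shift {m : ℕ} (j : Fin m) : Fin m := ⟨(j + m / 2) % m, Nat.mod_lt _ j.pos⟩

theorem shift_eq {m : ℕ} (j : Fin m) :
    ((shift j : ℕ) : ℤ) = j + m / 2 ∨ ((shift j : ℕ) : ℤ) = j + m / 2 - m := by
  have hj := j.2
  have h : (shift j : ℕ) = (j + m / 2) % m := rfl
  rcases lt_or_ge ((j : ℕ) + m / 2) m with h1 | h1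
  · left; rw [h, Nat.mod_eq_of_lt h1]; push_cast; rfl
  · right
    rw [h, Nat.mod_eq_sub_mod h1, Nat.mod_eq_of_lt (by omega)]
    omega

theorem shift_injective {m : ℕ} : Function.Injective (shift : Fin m → Fin m) := by
  intro a b hab
  have h1 := shift_eq a
  have h2 := shift_eq b
  rw [hab] at h1
  have := a.2
  have := b.2
  exact Fin.ext (by omega)

theorem shift_shift {m : ℕ} (hm : Even m) (j : Fin m) : shift (shift j) = j := by
  have h1 := shift_eq j
  have h2 := shift_eq (shift j)
  have := j.2
  have := (shift (shift j)).2
  have := (shift j).2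
  obtain ⟨r, rfl⟩ := hm
  exact Fin.ext (by omega)

/-- Shifting `j` by `m / 2` moves the exponent by `m - m % 2` modulo `2 m`; for odd `m` the missing
unit must be added back. -/
theorem cos_mom_shift {m n : ℕ} (j : Fin m) :
    Real.cos (Real.pi * ((mom n (shift j : ℕ) : ℝ) + ((m % 2 : ℕ) : ℝ)) / m) =
      -Real.cos (Real.pi * mom n (j : ℕ) / m) := by
  have hm : (m : ℝ) ≠ 0 := by exact_mod_cast j.pos.ne'
  have h1 : (m : ℝ) = 2 * (((m : ℤ) / 2 : ℤ) : ℝ) + ((m % 2 : ℕ) : ℝ) := by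
    have : (m : ℤ) = 2 * ((m : ℤ) / 2) + ((m % 2 : ℕ) : ℤ) := by omega
    have h2 := congrArg (fun z : ℤ => (z : ℝ)) this
    simpa only [Int.cast_add, Int.cast_mul, Int.cast_natCast, Int.cast_ofNat] using h2
  rw [← Real.cos_add_pi]
  rcases shift_eq j with h | h
  · congr 1
    rw [mom, mom, h]
    rw [div_add' _ _ _ hm]
    congr 1
    push_cast at h1 ⊢
    linear_combination -Real.pi * h1
  · rw [← Real.cos_sub_two_pi (Real.pi * mom n (j : ℕ) / m + Real.pi), ← Real.cos_neg,
      ← Real.cos_neg (_ - _)]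
    congr 2
    rw [mom, mom, h]
    rw [div_add' _ _ _ hm, div_sub' hm]
    congr 1
    push_cast at h1 ⊢
    linear_combination -Real.pi * h1

theorem neg_eig_eq {m n : ℕ} (p : Fin n → Fin m) :
    -eig m p = ∑ i, 2 * Real.cos (Real.pi *
      ((mom n (shift (p i) : ℕ) : ℝ) + ((m % 2 : ℕ) : ℝ)) / m) := by
  simp_rw [cos_mom_shift, eig, ← Finset.sum_neg_distrib]
  exact Finset.sum_congr rfl fun i _ => by ring

theorem neg_eig_eq_of_even {m n : ℕ} (hm : Even m) (p : Fin n → Fin m) :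
    -eig m p = eig m (shift ∘ p) := by
  rw [neg_eig_eq, Nat.even_iff.1 hm, eig]
  simp

/-- For odd `m` the negated spectrum uses exponents off by one, so the best filling is off centre
and loses the factor `cos (π / m)`. -/
theorem neg_eig_le_of_odd {m n : ℕ} (hm : 2 ≤ m) (hodd : Odd m) (h : n ≤ m) {p : Fin n → Fin m}
    (hp : Function.Injective p) : -eig m p ≤ topEig m n * Real.cos (Real.pi * 1 / m) := by
  have H := sum_le_of_threshold h
    (fun j : Fin m => 2 * Real.cos (Real.pi * ((mom n (j : ℕ) + 1 : ℤ) : ℝ) / m))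
    (2 * Real.cos (Real.pi * n / m))
    (fun j hj => by
      have := cos_threshold_le hm (n := n) (e := mom n (j : ℕ) + 1) (by rw [mom]; omega)
        (by rw [mom]; omega) h
      linarith)
    (fun j hj => by
      have := cos_le_threshold hm (n := n) (e := mom n (j : ℕ) + 1) (by rw [mom]; omega)
        (by rw [mom]; omega)
      linarith) (shift_injective.comp hp)
  rw [neg_eig_eq, ← sum_cos_ground hm n 1, Nat.odd_iff.1 hodd]
  simpa [ground] using H.1

theorem topEig_nonneg {m n : ℕ} (hm : 2 ≤ m) (h : n ≤ m) : 0 ≤ topEig m n := by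
  have hm' : (0 : ℝ) < m := by exact_mod_cast (by omega : 0 < m)
  have h' : (n : ℝ) ≤ m := by exact_mod_cast h
  have := sin_pi_div_pos hm
  have : 0 ≤ Real.sin (n * Real.pi / m) := Real.sin_nonneg_of_nonneg_of_le_pi
    (by have := Real.pi_pos; positivity)
    (by rw [div_le_iff₀ hm', mul_comm]; exact mul_le_mul_of_nonneg_left h' Real.pi_pos.le)
  unfold topEig
  positivity

theorem topEig_pos {m n : ℕ} (hn : 1 ≤ n) (h : n < m) : 0 < topEig m n := by
  have h1 := sin_pi_div_pos (m := m) (by omega)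
  have h2 := sin_pos_of_range (m := m) (d := n) (by omega) (by omega)
  have h3 : Real.pi * ((n : ℤ) : ℝ) / m = n * Real.pi / m := by push_cast; ring
  rw [h3] at h2
  unfold topEig
  positivity

theorem abs_eig_le {m n : ℕ} (hm : 2 ≤ m) (h : n ≤ m) {p : Fin n → Fin m}
    (hp : Function.Injective p) : |eig m p| ≤ topEig m n := by
  refine abs_le.2 ⟨?_, (eig_le hm h hp).1⟩
  rcases Nat.even_or_odd m with he | ho
  · have := (eig_le hm h (shift_injective.comp hp)).1
    rw [← neg_eig_eq_of_even he] at this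
    linarith
  · have h1 := neg_eig_le_of_odd hm ho h hp
    have := mul_le_mul_of_nonneg_left (Real.cos_le_one (Real.pi * 1 / m)) (topEig_nonneg hm h)
    linarith

theorem exists_perm_of_eig_eq_neg {m n : ℕ} (hm : 2 ≤ m) (he : Even m) (h : n ≤ m)
    {p : Fin n → Fin m} (hp : Function.Injective p) (hpe : eig m p = -topEig m n) :
    ∃ σ : Equiv.Perm (Fin n), p = (shift ∘ ground h) ∘ σ := by
  obtain ⟨σ, hσ⟩ := (eig_le hm h (shift_injective.comp hp)).2
    (by rw [← neg_eig_eq_of_even he, hpe, neg_neg])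
  refine ⟨σ, ?_⟩
  rw [Function.comp_assoc, ← hσ]
  ext i
  simp [shift_shift he]

theorem eig_ne_neg_of_odd {m n : ℕ} (hm : 2 ≤ m) (ho : Odd m) (hn : 1 ≤ n) (h : n < m)
    {p : Fin n → Fin m} (hp : Function.Injective p) : eig m p ≠ -topEig m n := by
  intro hpe
  have h1 := neg_eig_le_of_odd hm ho h.le hp
  have h2 := topEig_pos hn h
  have hm' : (0 : ℝ) < m := by exact_mod_cast (by omega : 0 < m)
  have h3 : Real.cos (Real.pi * 1 / m) < 1 := by
    have h4 : Real.pi * 1 / m ≤ Real.pi := by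
      rw [div_le_iff₀ hm']
      have : (1 : ℝ) ≤ m := by exact_mod_cast (by omega : 1 ≤ m)
      exact mul_le_mul_of_nonneg_left this Real.pi_pos.le
    have h5 : 0 < Real.pi * 1 / m := by
      have := Real.pi_pos
      positivity
    simpa using Real.cos_lt_cos_of_nonneg_of_le_pi le_rfl h4 h5
  have := mul_lt_mul_of_pos_left h3 h2
  linarith

/-! ### Isolating the dominant eigenvalues. -/

/-- The signs of `coef` and `slater` under a permutation cancel, so the `n!` rearrangements of `p₀`
contribute equally. Non-injective `p` contribute nothing. -/
theorem sum_filter_eig {m n : ℕ} {p₀ : Fin n → Fin m} (hp₀ : Function.Injective p₀) {μ : ℝ}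
    (h0 : eig m p₀ = μ) (huniq : ∀ p : Fin n → Fin m, Function.Injective p → eig m p = μ →
      ∃ σ : Equiv.Perm (Fin n), p = p₀ ∘ σ) (x : Fin n → ℤ) :
    ∑ p : Fin n → Fin m, (if eig m p = μ then coef m p * slater m p x else 0) =
      n.factorial * (coef m p₀ * slater m p₀ x) := by
  classical
  have h1 : ∑ p ∈ univ.image (fun σ : Equiv.Perm (Fin n) => p₀ ∘ σ),
      (if eig m p = μ then coef m p * slater m p x else 0) =
      ∑ p : Fin n → Fin m, (if eig m p = μ then coef m p * slater m p x else 0) := by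
    apply Finset.sum_subset (Finset.subset_univ _)
    intro p _ hp
    split_ifs with he
    · rw [slater_eq_zero, mul_zero]
      intro hinj
      obtain ⟨σ, hσ⟩ := huniq p hinj he
      exact hp (Finset.mem_image.2 ⟨σ, mem_univ _, hσ.symm⟩)
    · rfl
  rw [← h1, Finset.sum_image]
  · have h2 : ∀ σ : Equiv.Perm (Fin n), (if eig m (p₀ ∘ σ) = μ then
        coef m (p₀ ∘ σ) * slater m (p₀ ∘ σ) x else 0) = coef m p₀ * slater m p₀ x := fun σ => by
      rw [eig_comp_perm, if_pos h0, coef_comp_perm, slater_comp_perm]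
      linear_combination (coef m p₀ * slater m p₀ x) * sign_mul_sign σ
    simp_rw [h2]
    rw [Finset.sum_const, Finset.card_univ, Fintype.card_perm, Fintype.card_fin, nsmul_eq_mul]
  · intro σ _ τ _ h
    ext i
    exact congrArg _ (hp₀ (congrFun h i))

/-- The counting function up to lower exponential order. -/
theorem numWalks_sub_isLittleO {m n : ℕ} (hn : 1 ≤ n) (h : n < m) {η : Fin n → ℤ}
    (hη : StrictAnti η) (h0 : ∀ h, 0 ≤ η h) (h1 : ∀ h, η h < m) {A : ℂ}
    (hAe : Even m → A = coef m (shift ∘ ground h.le) * slater m (shift ∘ ground h.le) η)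
    (hAo : Odd m → A = 0) :
    (fun k : ℕ => (numWalks m η k : ℂ) - ((m : ℂ) ^ n)⁻¹ *
      ((topEig m n : ℂ) ^ k * (coef m (ground h.le) * slater m (ground h.le) η) +
        (-(topEig m n : ℂ)) ^ k * A)) =o[atTop] fun k => topEig m n ^ k := by
  have hm : 2 ≤ m := by omega
  have hpos := topEig_pos hn h
  have hf : (n.factorial : ℂ) ≠ 0 := by exact_mod_cast n.factorial_ne_zero
  have hG := sum_filter_eig (ground_injective h.le) (eig_ground hm h.le)
    (fun p hp => (eig_le hm h.le hp).2) η
  have hG' : ∑ p : Fin n → Fin m,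
      (if eig m p = -topEig m n then coef m p * slater m p η else 0) = n.factorial * A := by
    rcases Nat.even_or_odd m with he | ho
    · rw [hAe he]
      refine sum_filter_eig (shift_injective.comp (ground_injective h.le)) ?_
        (fun p hp hpe => exists_perm_of_eig_eq_neg hm he h.le hp hpe) η
      rw [← eig_ground hm h.le, ← neg_eig_eq_of_even he]
    · rw [hAo ho, mul_zero]
      refine Finset.sum_eq_zero fun p _ => ?_
      split_ifs with hpe
      · rw [slater_eq_zero, mul_zero]
        exact fun hp => eig_ne_neg_of_odd hm ho hn h hp hpe
      · rfl
  -- Every remaining term has an eigenvalue of strictly smaller modulus or a vanishing Slater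
  -- determinant.
  have hrem : (fun k : ℕ => ∑ p : Fin n → Fin m, if eig m p = topEig m n ∨ eig m p = -topEig m n
      then 0 else (eig m p : ℂ) ^ k * (coef m p * slater m p η)) =o[atTop]
      fun k => topEig m n ^ k := by
    refine IsLittleO.fun_sum fun p _ => ?_
    by_cases hpe : eig m p = topEig m n ∨ eig m p = -topEig m n
    · simp only [hpe, if_true]
      exact isLittleO_zero _ _
    · simp only [hpe, if_false]
      by_cases hp : Function.Injective p
      · push Not at hpe
        have hlt : |eig m p| < |topEig m n| := by
          rw [abs_of_pos hpos]
          refine lt_of_le_of_ne (abs_eig_le hm h.le hp) fun hc => ?_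
          rcases (abs_eq hpos.le).1 hc with hc | hc
          · exact hpe.1 hc
          · exact hpe.2 hc
        have h2 := (isLittleO_pow_pow_of_abs_lt_left hlt).norm_left.const_mul_left
          ‖coef m p * slater m p η‖
        refine IsLittleO.of_norm_left (h2.congr_left fun k => ?_)
        rw [norm_mul _ (coef m p * _), norm_pow, norm_pow, Complex.norm_real, mul_comm]
      · simp only [slater_eq_zero m hp, mul_zero]
        exact isLittleO_zero _ _
  refine (hrem.const_mul_left ((n.factorial : ℂ)⁻¹ * ((m : ℂ) ^ n)⁻¹)).congr_left fun k => ?_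
  have hW : (numWalks m η k : ℂ) = wave m k η := by
    obtain ⟨n, rfl⟩ : ∃ n', n = n' + 1 := ⟨n - 1, by omega⟩
    exact numWalks_eq_wave (by omega) hη h0 h1 k
  have hsplit : ∑ p : Fin n → Fin m, (eig m p : ℂ) ^ k * coef m p * slater m p η =
      (topEig m n : ℂ) ^ k * (n.factorial * (coef m (ground h.le) * slater m (ground h.le) η)) +
      (-(topEig m n : ℂ)) ^ k * (n.factorial * A) +
      ∑ p : Fin n → Fin m, if eig m p = topEig m n ∨ eig m p = -topEig m n
        then 0 else (eig m p : ℂ) ^ k * (coef m p * slater m p η) := by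
    rw [← hG, ← hG', Finset.mul_sum, Finset.mul_sum, ← Finset.sum_add_distrib,
      ← Finset.sum_add_distrib]
    refine Finset.sum_congr rfl fun p _ => ?_
    have hne : topEig m n ≠ -topEig m n := by linarith
    by_cases e1 : eig m p = topEig m n
    · simp [e1, hne, mul_assoc]
    · by_cases e2 : eig m p = -topEig m n
      · simp [e2, hne.symm, mul_assoc]
      · simp [e1, e2, mul_assoc]
  have hfac := factorial_mul_wave m k η
  rw [hsplit, ← hW] at hfac
  field_simp at hfac ⊢
  linear_combination -hfac

/-! ### The shifted state and the full circle. -/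

theorem coef_ground_eq {m n : ℕ} (h : n ≤ m) :
    coef m (ground h) = signedSum m (twisted m n 1) := by
  refine Finset.sum_congr rfl fun s _ => ?_
  congr 1
  refine Finset.prod_congr rfl fun i _ => ?_
  rw [twisted, one_mul, ← zpow_natCast, ← zpow_mul]
  congr 1
  simp [ground]

theorem zeta_mom_shift {m : ℕ} (he : Even m) (n : ℕ) (j : Fin m) :
    zeta m ^ mom n (shift j : ℕ) = -zeta m ^ mom n (j : ℕ) := by
  have hm : m ≠ 0 := j.pos.ne'
  have h2 : 2 * ((m : ℤ) / 2) = m := by obtain ⟨r, rfl⟩ := he; omega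
  have h1 : mom n (shift j : ℕ) = mom n (j : ℕ) + m * 1 ∨
      mom n (shift j : ℕ) = mom n (j : ℕ) + m * (-1) := by
    rcases shift_eq j with h | h
    · left; rw [mom, mom]; omega
    · right; rw [mom, mom]; omega
  rcases h1 with h | h
  · rw [h, zpow_add₀ (zeta_ne_zero m), zeta_zpow_mul hm]; simp
  · rw [h, zpow_add₀ (zeta_ne_zero m), zeta_zpow_mul hm]; simp

theorem coef_shift_eq {m n : ℕ} (he : Even m) (h : n ≤ m) :
    coef m (shift ∘ ground h) = signedSum m (twisted m n (-1)) := by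
  refine Finset.sum_congr rfl fun s _ => ?_
  congr 1
  refine Finset.prod_congr rfl fun i _ => ?_
  have h1 := zeta_mom_shift he n (ground h i)
  rw [twisted, ← neg_mul, zpow_mul, zpow_natCast, zpow_neg, Function.comp_apply, h1,
    inv_neg, zpow_neg]
  simp [ground]

/-- The shift negates each root of unity, giving column `j` the sign `(-1) ^ x j`; this is the
source of `(-1)^|η|`. -/
theorem slater_shift {m n : ℕ} (he : Even m) (p : Fin n → Fin m) (x : Fin n → ℤ) :
    slater m (shift ∘ p) x = (-1) ^ (∑ j, x j) * slater m p x := by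
  have h1 : slater m (shift ∘ p) x = (Matrix.of fun i j => ((-1 : ℂ) ^ x j) *
      (Matrix.of fun i j => zeta m ^ (mom n (p i : ℕ) * x j)) i j).det := by
    rw [slater]
    congr 1
    ext i j
    simp only [Matrix.of_apply, Function.comp_apply]
    rw [zpow_mul, zeta_mom_shift he, neg_eq_neg_one_mul, mul_zpow, zpow_mul]
  rw [h1, Matrix.det_mul_row, slater]
  congr 1
  induction (univ : Finset (Fin n)) using Finset.induction_on with
  | empty => simp
  | insert a s ha ih =>
    rw [Finset.prod_insert ha, Finset.sum_insert ha, zpow_add₀ (by norm_num), ih]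

/-- With `n = m` the top eigenvalue is a multiple of `sin π = 0`, so all eigenvalues that matter
vanish. -/
theorem numWalks_eq_zero_of_full {m : ℕ} (hm : 2 ≤ m) {η : Fin m → ℤ}
    (hη : StrictAnti η) (h0 : ∀ h, 0 ≤ η h) (h1 : ∀ h, η h < m) {k : ℕ} (hk : k ≠ 0) :
    numWalks m η k = 0 := by
  have hW : (numWalks m η k : ℂ) = wave m k η := by
    obtain ⟨n, hn⟩ : ∃ n', m = n' + 1 := ⟨m - 1, by omega⟩
    have key : ∀ (n : ℕ) (η : Fin n → ℤ), 1 ≤ n → StrictAnti η → (∀ h, 0 ≤ η h) →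
        (∀ h, η h < m) → (numWalks m η k : ℂ) = wave m k η := by
      intro n η hn hη h0 h1
      obtain ⟨n, rfl⟩ : ∃ n', n = n' + 1 := ⟨n - 1, by omega⟩
      exact numWalks_eq_wave (by omega) hη h0 h1 k
    exact key m η (by omega) hη h0 h1
  have htop : topEig m m = 0 := by
    have : (m : ℝ) ≠ 0 := by exact_mod_cast (by omega : m ≠ 0)
    rw [topEig, mul_div_assoc, mul_div_cancel₀ _ this]
    simp
  have hfac := factorial_mul_wave m k η
  rw [Finset.sum_eq_zero, mul_zero, ← hW] at hfac
  · have hf : (m.factorial : ℂ) ≠ 0 := by exact_mod_cast m.factorial_ne_zero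
    exact_mod_cast (mul_eq_zero.1 hfac).resolve_left hf
  · intro p _
    by_cases hp : Function.Injective p
    · have := abs_eig_le hm le_rfl hp
      rw [htop, abs_nonpos_iff] at this
      rw [this]
      simp [hk]
    · rw [slater_eq_zero m hp, mul_zero]

/-! ### Positivity and comparison of the trigonometric products. -/

theorem evenAngle_pos {m h : ℕ} (hm : 0 < m) (hh : 1 ≤ h) : 0 < evenAngle m h := by
  have hm' : (0 : ℝ) < m := by exact_mod_cast hm
  have : (1 : ℝ) ≤ h := by exact_mod_cast hh
  have := Real.pi_pos
  have : 0 < 2 * (h : ℝ) - 1 := by linarith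
  unfold evenAngle
  positivity

theorem evenAngle_lt {m h : ℕ} (hh : 2 * h ≤ m) (hm : 0 < m) : evenAngle m h < Real.pi / 2 := by
  have hm' : (0 : ℝ) < m := by exact_mod_cast hm
  have : 2 * (h : ℝ) ≤ m := by exact_mod_cast hh
  have := Real.pi_pos
  unfold evenAngle
  rw [div_lt_div_iff₀ (by positivity) (by norm_num)]
  nlinarith

theorem cot_pos {x : ℝ} (h0 : 0 < x) (h1 : x < Real.pi / 2) : 0 < Real.cot x := by
  rw [Real.cot_eq_cos_div_sin]
  exact div_pos (Real.cos_pos_of_mem_Ioo ⟨by linarith [Real.pi_pos], h1⟩)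
    (Real.sin_pos_of_pos_of_lt_pi h0 (by linarith [Real.pi_pos]))

theorem prod_cot_evenAngle_pos {m r : ℕ} (hr : 2 * r ≤ m) :
    0 < ∏ h ∈ Icc 1 r, Real.cot (evenAngle m h) := by
  refine Finset.prod_pos fun h hh => ?_
  rw [Finset.mem_Icc] at hh
  exact cot_pos (evenAngle_pos (by omega) hh.1) (evenAngle_lt (by omega) (by omega))

theorem prod_cot_pos {m r : ℕ} (hr : 2 * r + 1 ≤ m) :
    0 < ∏ h ∈ Icc 1 r, Real.cot ((h : ℝ) * Real.pi / m) := by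
  refine Finset.prod_pos fun h hh => ?_
  rw [Finset.mem_Icc] at hh
  have hm' : (0 : ℝ) < m := by exact_mod_cast (by omega : 0 < m)
  have h1 : (1 : ℝ) ≤ h := by exact_mod_cast hh.1
  have h2 : 2 * (h : ℝ) < m := by exact_mod_cast (by omega : 2 * h < m)
  have := Real.pi_pos
  refine cot_pos (by positivity) ?_
  rw [div_lt_div_iff₀ hm' (by norm_num)]
  nlinarith

theorem prod_tan_evenAngle_pos {m r : ℕ} (hr : 2 * r ≤ m) :
    0 < ∏ h ∈ Icc 1 r, Real.tan (evenAngle m h) := by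
  refine Finset.prod_pos fun h hh => ?_
  rw [Finset.mem_Icc] at hh
  exact Real.tan_pos_of_pos_of_lt_pi_div_two (evenAngle_pos (by omega) hh.1)
    (evenAngle_lt (by omega) (by omega))

/-- Reverse the order of the cotangents: the angles `h` and `r + 1 - h` add up to `r π / m < π / 2`,
so each tangent is below the matching cotangent. -/
theorem prod_tan_lt_prod_cot {m r : ℕ} (h1 : 1 ≤ r) (hr : 2 * r < m) :
    ∏ h ∈ Icc 1 r, Real.tan (evenAngle m h) < ∏ h ∈ Icc 1 r, Real.cot (evenAngle m h) := by
  have hm' : (0 : ℝ) < m := by exact_mod_cast (by omega : 0 < m)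
  have hrefl : ∏ h ∈ Icc 1 r, Real.cot (evenAngle m h) =
      ∏ h ∈ Icc 1 r, Real.cot (evenAngle m (r + 1 - h)) := by
    refine Finset.prod_bij' (fun h _ => r + 1 - h) (fun h _ => r + 1 - h) ?_ ?_ ?_ ?_ ?_ <;>
      intro h hh <;> rw [Finset.mem_Icc] at hh
    · rw [Finset.mem_Icc]; omega
    · rw [Finset.mem_Icc]; omega
    · omega
    · omega
    · rw [show r + 1 - (r + 1 - h) = h by omega]
  rw [hrefl]
  refine Finset.prod_lt_prod_of_nonempty ?_ ?_ ⟨1, by rw [Finset.mem_Icc]; omega⟩ <;>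
    intro h hh <;> rw [Finset.mem_Icc] at hh
  · exact Real.tan_pos_of_pos_of_lt_pi_div_two (evenAngle_pos (by omega) hh.1)
      (evenAngle_lt (by omega) (by omega))
  · have hc : Real.cot (evenAngle m (r + 1 - h)) =
        Real.tan (Real.pi / 2 - evenAngle m (r + 1 - h)) := by
      rw [Real.tan_pi_div_two_sub, Real.tan_inv_eq_cot]
    rw [hc]
    have hpos := evenAngle_pos (m := m) (h := r + 1 - h) (by omega) (by omega)
    have hpos' := evenAngle_pos (m := m) (h := h) (by omega) (by omega)
    refine Real.tan_lt_tan_of_lt_of_lt_pi_div_two (by linarith [Real.pi_pos]) (by linarith) ?_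
    have hr' : 2 * (r : ℝ) < m := by exact_mod_cast hr
    have : 0 < (m - 2 * (r : ℝ)) * Real.pi / (2 * m) := by
      have := Real.pi_pos
      have : 0 < (m : ℝ) - 2 * r := by linarith
      positivity
    have e : Real.pi / 2 - evenAngle m (r + 1 - h) - evenAngle m h =
        (m - 2 * (r : ℝ)) * Real.pi / (2 * m) := by
      rw [evenAngle, evenAngle, Nat.cast_sub (by omega)]
      push_cast
      field_simp
      ring
    linarith

/-! ### Assembling the asymptotics. -/

theorem isEquivalent_of_sub_isLittleO {u b : ℕ → ℝ} {L δ : ℝ} (hL : 0 < L) (hδ : 0 < δ)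
    (hb : ∀ k, δ ≤ b k) (h : (fun k => u k - L ^ k * b k) =o[atTop] fun k => L ^ k) :
    u ~[atTop] fun k => L ^ k * b k := by
  refine h.trans_isBigO (IsBigO.of_bound δ⁻¹ (Eventually.of_forall fun k => ?_))
  have hk : 0 < L ^ k := by positivity
  have hbk : 0 < b k := hδ.trans_le (hb k)
  rw [Real.norm_of_nonneg hk.le, Real.norm_of_nonneg (by positivity)]
  rw [inv_mul_eq_div, le_div_iff₀ hδ]
  exact mul_le_mul_of_nonneg_left (hb k) hk.le

theorem isLittleO_of_ofReal {u v : ℕ → ℝ} (h : (fun k => (u k : ℂ)) =o[atTop] v) :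
    u =o[atTop] v :=
  IsLittleO.of_norm_left (h.norm_left.congr_left fun _ => Complex.norm_real _)

theorem isEquivalent_of_full {m : ℕ} (hm : 2 ≤ m) {η : Fin m → ℤ}
    (hη : StrictAnti η) (h0 : ∀ h, 0 ≤ η h) (h1 : ∀ h, η h < m) (c d : ℝ) (b : ℕ → ℝ) :
    (fun k : ℕ => (numWalks m η k : ℝ)) ~[atTop] fun k => c * topEig m m ^ k * d * b k := by
  have htop : topEig m m = 0 := by
    have : (m : ℝ) ≠ 0 := by exact_mod_cast (by omega : m ≠ 0)
    rw [topEig, mul_div_assoc, mul_div_cancel₀ _ this]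
    simp
  refine EventuallyEq.isEquivalent ?_
  filter_upwards [eventually_ne_atTop 0] with k hk
  rw [numWalks_eq_zero_of_full hm hη h0 h1 hk, htop]
  simp [hk]

theorem coef_mul_slater_ground {m n : ℕ} (h : n ≤ m) (η : Fin n → ℤ) :
    coef m (ground h) * slater m (ground h) η =
      ((2 ^ n.choose 2 * ‖coef m (ground h)‖ * sinProd m η : ℝ) : ℂ) := by
  rw [slater_ground, ← mul_assoc, coef_ground_mul]
  push_cast
  ring

theorem norm_coef_even {m r : ℕ} (h : 2 * r ≤ m) :
    ‖coef m (ground h)‖ = (m : ℝ) ^ r * ∏ h ∈ Icc 1 r, Real.cot (evenAngle m h) := by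
  rw [coef_ground_eq, signedSum_one_even h, norm_mul, norm_pow, norm_mul, Complex.norm_I,
    Complex.norm_real, Complex.norm_natCast, one_mul,
    Real.norm_of_nonneg (prod_cot_evenAngle_pos h).le]

theorem norm_coef_odd {m r : ℕ} (h : 2 * r + 1 ≤ m) :
    ‖coef m (ground h)‖ =
      (m : ℝ) ^ (r + 1) * ∏ h ∈ Icc 1 r, Real.cot ((h : ℝ) * Real.pi / m) := by
  rw [coef_ground_eq, signedSum_one_odd h, norm_mul, norm_mul, norm_pow, norm_mul, norm_neg,
    Complex.norm_I, Complex.norm_real, Complex.norm_natCast, one_mul,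
    Real.norm_of_nonneg (prod_cot_pos h).le]
  ring

theorem coef_mul_slater_shift_even {m r : ℕ} (he : Even m) (h : 2 * r ≤ m)
    (η : Fin (2 * r) → ℤ) :
    coef m (shift ∘ ground h) * slater m (shift ∘ ground h) η =
      (((-1) ^ ((∑ h, η h) + (r : ℤ)) * (2 ^ (2 * r).choose 2 * ((m : ℝ) ^ r *
        ∏ h ∈ Icc 1 r, Real.tan (evenAngle m h)) * sinProd m η) : ℝ) : ℂ) := by
  have hc : ((∏ h ∈ Icc 1 r, Real.cot (evenAngle m h) : ℝ) : ℂ) ≠ 0 := by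
    exact_mod_cast (prod_cot_evenAngle_pos h).ne'
  have h1 := coef_ground_mul h
  rw [norm_coef_even, coef_ground_eq, signedSum_one_even h] at h1
  -- The phase is read off from the ground state by cancelling the nonzero cotangent product; the
  -- shifted state differs by `(-1) ^ r`.
  have h2 : (Complex.I * m) ^ r * vdmConst (2 * r) = 2 ^ (2 * r).choose 2 * (m : ℂ) ^ r := by
    apply mul_right_cancel₀ hc
    push_cast at h1 ⊢
    linear_combination h1
  rw [coef_shift_eq he, slater_shift he, signedSum_neg_one_even h he, slater_ground,
    zpow_add₀ (by norm_num), zpow_natCast, neg_mul, neg_pow]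
  push_cast
  linear_combination ((-1 : ℂ) ^ r * (-1) ^ (∑ h, η h) * sinProd m η *
    ∏ h ∈ Icc 1 r, Complex.tan (evenAngle m h)) * h2

end CircleWalk

theorem mainTheorem6 (m n : ℕ) (hm : 2 ≤ m) (hn : 1 ≤ n) (η : Fin n → ℤ)
    (hη : StrictAnti η) (hη_nonneg : ∀ h, 0 ≤ η h) (hη_lt : ∀ h, η h < (m : ℤ)) :
    (Even n → Even m →
      (fun k : ℕ => (CircleWalk.numWalks m η k : ℝ)) ~[atTop] fun k : ℕ =>
        (2 : ℝ) ^ n.choose 2 / (m : ℝ) ^ (n / 2) *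
          (2 * (Real.sin (n * Real.pi / m) / Real.sin (Real.pi / m))) ^ k *
          CircleWalk.sinProd m η *
          (∏ h ∈ Finset.Icc 1 (n / 2), Real.cot ((2 * (h : ℝ) - 1) * Real.pi / (2 * m)) +
            (-1 : ℝ) ^ ((∑ h, η h) + (k : ℤ) + ((n / 2 : ℕ) : ℤ)) *
              ∏ h ∈ Finset.Icc 1 (n / 2), Real.tan ((2 * (h : ℝ) - 1) * Real.pi / (2 * m)))) ∧
    (Even n → Odd m →
      (fun k : ℕ => (CircleWalk.numWalks m η k : ℝ)) ~[atTop] fun k : ℕ =>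
        (2 : ℝ) ^ n.choose 2 / (m : ℝ) ^ (n / 2) *
          (2 * (Real.sin (n * Real.pi / m) / Real.sin (Real.pi / m))) ^ k *
          CircleWalk.sinProd m η *
          ∏ h ∈ Finset.Icc 1 (n / 2), Real.cot ((2 * (h : ℝ) - 1) * Real.pi / (2 * m))) ∧
    (Odd n →
      (fun k : ℕ => (CircleWalk.numWalks m η k : ℝ)) ~[atTop] fun k : ℕ =>
        (2 : ℝ) ^ n.choose 2 / (m : ℝ) ^ ((n - 1) / 2) *
          (2 * (Real.sin (n * Real.pi / m) / Real.sin (Real.pi / m))) ^ k *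
          CircleWalk.sinProd m η *
          ∏ h ∈ Finset.Icc 1 ((n - 1) / 2), Real.cot ((h : ℝ) * Real.pi / m)) := by
  open CircleWalk Finset in
  have hmC : (m : ℂ) ≠ 0 := by exact_mod_cast (by omega : m ≠ 0)
  have hm1 : (0 : ℝ) < m := by exact_mod_cast (by omega : 0 < m)
  have hP := sinProd_pos hη hη_nonneg hη_lt
  have hnm : n ≤ m := by
    have : NeZero m := ⟨by omega⟩
    simpa [ZMod.card] using
      Fintype.card_le_of_injective _ (injective_of_strictAnti hη hη_nonneg hη_lt)
  rcases hnm.eq_or_lt with rfl | hlt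
  · exact ⟨fun _ _ => isEquivalent_of_full hm hη hη_nonneg hη_lt _ _ _,
      fun _ _ => isEquivalent_of_full hm hη hη_nonneg hη_lt _ _ fun _ => _,
      fun _ => isEquivalent_of_full hm hη hη_nonneg hη_lt _ _ fun _ => _⟩
  refine ⟨fun hne hme => ?_, fun hne hmo => ?_, fun hno => ?_⟩
  · obtain ⟨r, rfl⟩ := even_iff_exists_two_mul.1 hne
    have hpow : (m : ℂ) ^ (2 * r) = m ^ r * m ^ r := by rw [two_mul, pow_add]
    rw [Nat.mul_div_cancel_left r two_pos]
    have H := numWalks_sub_isLittleO hn hlt hη hη_nonneg hη_lt (fun _ => rfl)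
      (fun ho => absurd hme (Nat.not_even_iff_odd.2 ho))
    set C := ∏ h ∈ Icc 1 r, Real.cot (evenAngle m h) with hC
    set T := ∏ h ∈ Icc 1 r, Real.tan (evenAngle m h) with hT
    have hT0 : 0 < T := prod_tan_evenAngle_pos hlt.le
    have hCT : T < C := prod_tan_lt_prod_cot (by omega) hlt
    have key := isEquivalent_of_sub_isLittleO (u := fun k => (numWalks m η k : ℝ))
      (b := fun k => (2 : ℝ) ^ (2 * r).choose 2 / (m : ℝ) ^ r * sinProd m η *
        (C + (-1 : ℝ) ^ ((∑ h, η h) + (k : ℤ) + ((r : ℕ) : ℤ)) * T))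
      (L := topEig m (2 * r))
      -- The lower bound is the value at the unfavourable sign `-1`, positive because `T < C`.
      (δ := (2 : ℝ) ^ (2 * r).choose 2 / (m : ℝ) ^ r * sinProd m η * (C - T))
      (topEig_pos hn hlt) (mul_pos (by positivity) (by linarith)) (fun k => ?_) ?_
    · refine key.congr_right (Eventually.of_forall fun k => ?_)
      simp only [topEig, evenAngle, hC, hT]
      ring
    · refine mul_le_mul_of_nonneg_left ?_ (by positivity)
      rcases Int.even_or_odd ((∑ h, η h) + (k : ℤ) + ((r : ℕ) : ℤ)) with h | h
      · rw [h.neg_one_zpow]; linarith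
      · rw [h.neg_one_zpow]; linarith
    · refine isLittleO_of_ofReal (H.congr_left fun k => ?_)
      rw [coef_mul_slater_ground, coef_mul_slater_shift_even hme, norm_coef_even, ← hC, ← hT,
        neg_pow (topEig m (2 * r) : ℂ) k, add_right_comm, zpow_add₀ (by norm_num) _ (k : ℤ),
        zpow_natCast, hpow]
      push_cast
      field_simp
  · obtain ⟨r, rfl⟩ := even_iff_exists_two_mul.1 hne
    have hpow : (m : ℂ) ^ (2 * r) = m ^ r * m ^ r := by rw [two_mul, pow_add]
    rw [Nat.mul_div_cancel_left r two_pos]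
    have H := numWalks_sub_isLittleO hn hlt hη hη_nonneg hη_lt (A := 0)
      (fun he => absurd he (Nat.not_even_iff_odd.2 hmo)) (fun _ => rfl)
    set C := ∏ h ∈ Icc 1 r, Real.cot (evenAngle m h) with hC
    have hC0 : 0 < C := prod_cot_evenAngle_pos hlt.le
    have key := isEquivalent_of_sub_isLittleO (u := fun k => (numWalks m η k : ℝ))
      (b := fun k => (2 : ℝ) ^ (2 * r).choose 2 / (m : ℝ) ^ r * sinProd m η * C)
      (L := topEig m (2 * r)) (topEig_pos hn hlt) (mul_pos (by positivity) hC0)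
      (fun k => le_rfl) ?_
    · refine key.congr_right (Eventually.of_forall fun k => ?_)
      simp only [topEig, evenAngle, hC]
      ring
    · refine isLittleO_of_ofReal (H.congr_left fun k => ?_)
      rw [coef_mul_slater_ground, norm_coef_even, ← hC, mul_zero, add_zero, hpow]
      push_cast
      field_simp
  · obtain ⟨r, rfl⟩ := hno
    rw [Nat.add_sub_cancel, Nat.mul_div_cancel_left r two_pos]
    have H := numWalks_sub_isLittleO hn hlt hη hη_nonneg hη_lt (A := 0)
      -- For even `m` the eigenvalue `-topEig` does occur, but `chi` has no component there.
      (fun he => by rw [coef_shift_eq he, signedSum_neg_one_odd hnm he, zero_mul]) (fun _ => rfl)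
    set C := ∏ h ∈ Icc 1 r, Real.cot ((h : ℝ) * Real.pi / m) with hC
    have hC0 : 0 < C := prod_cot_pos hlt.le
    have key := isEquivalent_of_sub_isLittleO (u := fun k => (numWalks m η k : ℝ))
      (b := fun k => (2 : ℝ) ^ (2 * r + 1).choose 2 / (m : ℝ) ^ r * sinProd m η * C)
      (L := topEig m (2 * r + 1)) (topEig_pos hn hlt) (mul_pos (by positivity) hC0)
      (fun k => le_rfl) ?_
    · refine key.congr_right (Eventually.of_forall fun k => ?_)
      simp only [topEig]
      ring
    · refine isLittleO_of_ofReal (H.congr_left fun k => ?_)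
      rw [coef_mul_slater_ground, norm_coef_odd, ← hC, mul_zero, add_zero]
      push_cast
      field_simp
      ring
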